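/- For $\mathrm{Re}\, s_1\ge 1$, $\mathrm{Re}\, s_2\ge 1$, $\mathrm{Re}\, s_3>1$ let $$\zeta_3(s_1,s_2,s_3)=\sum_{n_1\ge 1} n_1^{-s_1}\sum_{n_2>n_1} n_2^{-s_2}\sum_{n_3>n_2} n_3^{-s_3}.$$ This function has a unique holomorphic continuation, still denoted $\zeta_3$, to the complement in $\mathbb C^3$ of the hyperplanes $s_3=1$, $s_2+s_3=2-l$ and $s_1+s_2+s_3=3-l$ $(l=0,1,2,\dots)$. For each integer $k\ge 0$ let $\bar B_k=B_k(1)$, where $B_k(\alpha)$ is the $k$-th Bernoulli polynomial, defined by $\frac{ze^{\alpha z}}{e^z-1}=\sum_{n\ge 0}\frac{B_n(\alpha)}{n!}z^n$; let $\zeta$ be the Riemann zeta function. **Theorem.** Let $m_2,m_3\ge 0$ be integers, and let $s_1$ be a complex number such that either $\mathrm{Re}\, s_1\le 0$, or $\mathrm{Re}\, s_1>0$ and $s_1$ is not an integer. Then the iterated limit $$\zeta_3(s_1,-m_2,-m_3):=\lim_{s_1'\to s_1}\ \lim_{s_2'\to -m_2}\ \lim_{s_3'\to -m_3}\zeta_3(s_1',s_2',s_3')$$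 (the limit in $s_3'$ is taken first, and every limit is over a punctured neighbourhood) exists and $$\zeta_3(s_1,-m_2,-m_3)=\sum_{k_3=0}^{m_3+1}\binom{m_3+1}{k_3}\frac{\bar B_{k_3}}{m_3+1}\sum_{k_2=0}^{m_2+m_3+2-k_3}\binom{m_2+m_3+2-k_3}{k_2}\frac{\bar B_{k_2}}{m_2+m_3+2-k_3}\,\zeta\bigl(s_1-(m_2+m_3+2-k_2-k_3)\bigr).$$ -/

import Mathlib

open Filter Topology

noncomputable section

/-- The triple zeta series
`∑_{n₁ ≥ 1} n₁^{-s₁} ∑_{n₂ > n₁} n₂^{-s₂} ∑_{n₃ > n₂} n₃^{-s₃}`. -/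
def tripleZetaSeries (s₁ s₂ s₃ : ℂ) : ℂ :=
  ∑' n₁ : Set.Ici (1 : ℕ), ((n₁ : ℕ) : ℂ) ^ (-s₁) *
    ∑' n₂ : Set.Ioi (n₁ : ℕ), ((n₂ : ℕ) : ℂ) ^ (-s₂) *
      ∑' n₃ : Set.Ioi (n₂ : ℕ), ((n₃ : ℕ) : ℂ) ^ (-s₃)

/-- The connected dense open subset of `ℂ³` on which the triple zeta function is holomorphic: the
complement of a locally finite family of hyperplanes that contains every pole. -/
def tripleZetaDomain : Set (ℂ × ℂ × ℂ) :=
  {s | s.2.2 ≠ 1 ∧ (∀ l : ℕ, s.2.1 + s.2.2 ≠ 2 - l) ∧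
    (∀ l : ℕ, s.1 + s.2.1 + s.2.2 ≠ 3 - l)}

/-- `Z` is an analytic continuation of the triple zeta series: it is holomorphic on
`tripleZetaDomain`, and it equals the series for `Re s₁ ≥ 1`, `Re s₂ ≥ 1`, `Re s₃ > 1` (where the
series converges absolutely). The values of `Z` off `tripleZetaDomain` are irrelevant. -/
structure IsTripleZetaContinuation (Z : ℂ × ℂ × ℂ → ℂ) : Prop where
  differentiableAt : ∀ s ∈ tripleZetaDomain, DifferentiableAt ℂ Z s
  eq_series : ∀ s₁ s₂ s₃ : ℂ, 1 ≤ s₁.re → 1 ≤ s₂.re → 1 < s₃.re →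
    Z (s₁, s₂, s₃) = tripleZetaSeries s₁ s₂ s₃

open Classical in
/-- The triple zeta function `ζ₃(s₁, s₂, s₃)`: the analytic continuation of the triple zeta series
(the main theorem includes that it exists and is unique on `tripleZetaDomain`). -/
def tripleZeta : ℂ × ℂ × ℂ → ℂ :=
  if h : ∃ Z, IsTripleZetaContinuation Z then h.choose else 0

/-- The iterated limit `lim_{s₁ → a₁} lim_{s₂ → a₂} lim_{s₃ → a₃} Z(s₁, s₂, s₃)` (innermost limit in
`s₃`, all limits over punctured neighbourhoods) exists and equals `L`. Here `G s₁ s₂` is the value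
of the inner limit and `F s₁` is the value of the middle one. -/
def HasIteratedLimit (Z : ℂ × ℂ × ℂ → ℂ) (a₁ a₂ a₃ L : ℂ) : Prop :=
  ∃ (G : ℂ → ℂ → ℂ) (F : ℂ → ℂ),
    (∀ᶠ s₁ in 𝓝[≠] a₁, ∀ᶠ s₂ in 𝓝[≠] a₂,
      Tendsto (fun s₃ => Z (s₁, s₂, s₃)) (𝓝[≠] a₃) (𝓝 (G s₁ s₂))) ∧
    (∀ᶠ s₁ in 𝓝[≠] a₁, Tendsto (fun s₂ => G s₁ s₂) (𝓝[≠] a₂) (𝓝 (F s₁))) ∧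
    Tendsto F (𝓝[≠] a₁) (𝓝 L)

/-- `B̄ₖ = Bₖ(1)`, the value at `1` of the `k`-th Bernoulli polynomial. -/
def bernoulliBar (k : ℕ) : ℂ :=
  (((Polynomial.bernoulli k).eval 1 : ℚ) : ℂ)

end

/-! Let N = n + 1 be the middle summation variable. Summing over n₁ < N and n₃ > N first turns ζ₃
into ∑ a_N(s₁) N^(-s₂) T(s₃, N), where a_N is a partial sum of the zeta series and T its tail. T
continues to s₃ ≠ 1 as ζ(s₃) minus a finite sum, and Euler-Maclaurin expands it in the powers
N^(1-s₃-k), with a remainder that decays as fast as desired, uniformly on bounded sets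
(`exists_norm_tailRem_le`). Each power contributes a translate D(s₁, s₂+s₃+k-1) of the Dirichlet
series of a_N; on a given bounded set the remainder gives a convergent series once enough powers are
removed. So a continuation of D yields one of ζ₃ (`exists_continuation_tsum_mul_zetaTail`). Here D
is the double zeta function, itself continued in the same way from ζ.

At s₃ = -m the tail is exactly a polynomial in N, by Faulhaber's formula and the value ζ(-m)
(`zetaTail_neg_natCast`). Hence ζ₃(s₁, s₂, -m₃) is a finite combination of double zeta values, first
where the series converge and then by the identity theorem; likewise D(s, -M) reduces to values of
ζ. With s₁ and then s₂ generic, the two inner limits are evaluations at points of continuity; the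
condition on s₁ keeps the final zeta arguments away from the pole 1. -/

/-! ### Holomorphic series in several variables -/

/-- Cauchy's estimate in one variable, applied to `t ↦ f (x + t • v)` on the disc of radius `r /
‖v‖`. -/
theorem norm_fderiv_le_of_forall_mem_ball {E : Type*} [NormedAddCommGroup E] [NormedSpace ℂ E]
    {f : E → ℂ} {x : E} {r C : ℝ} (hr : 0 < r)
    (hf : ∀ y, ‖y - x‖ ≤ r → DifferentiableAt ℂ f y) (hC : ∀ y, ‖y - x‖ ≤ r → ‖f y‖ ≤ C) :
    ‖fderiv ℂ f x‖ ≤ C / r := by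
  have hC0 : 0 ≤ C := (norm_nonneg _).trans (hC x (by simpa using hr.le))
  refine ContinuousLinearMap.opNorm_le_bound _ (by positivity) fun v => ?_
  rcases eq_or_ne v 0 with rfl | hv
  · simp
  have hv' : 0 < ‖v‖ := norm_pos_iff.2 hv
  have hnorm : ∀ t : ℂ, ‖t‖ ≤ r / ‖v‖ → ‖x + t • v - x‖ ≤ r := fun t ht => by
    rw [add_sub_cancel_left, norm_smul]
    calc ‖t‖ * ‖v‖ ≤ r / ‖v‖ * ‖v‖ := by gcongr
      _ = r := by field_simp
  have hline : ∀ t : ℂ, HasDerivAt (fun t : ℂ => x + t • v) v t := fun t => by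
    simpa using ((hasDerivAt_id t).smul_const v).const_add x
  have hd : deriv (fun t : ℂ => f (x + t • v)) 0 = fderiv ℂ f x v := by
    have h1 : HasFDerivAt f (fderiv ℂ f x) (x + (0 : ℂ) • v) := by
      simpa using (hf x (by simpa using hr.le)).hasFDerivAt
    exact (h1.comp_hasDerivAt (0 : ℂ) (hline 0)).deriv
  rw [← hd]
  have hdiff : DifferentiableOn ℂ (fun t : ℂ => f (x + t • v)) (Metric.closedBall 0 (r / ‖v‖)) := by
    intro t ht
    have h1 := hf _ (hnorm t (by simpa using ht))
    exact (DifferentiableAt.comp t h1 (hline t).differentiableAt).differentiableWithinAt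
  have key := Complex.norm_deriv_le_of_forall_mem_sphere_norm_le (div_pos hr hv')
    (hdiff.diffContOnCl_ball subset_rfl)
    (fun t ht => hC _ (hnorm t (by simpa using (mem_sphere_zero_iff_norm.1 ht).le)))
  calc _ ≤ C / (r / ‖v‖) := key
    _ = C / r * ‖v‖ := by field_simp

/-- A series of holomorphic functions of several variables that is dominated by a summable
sequence on an open set has a holomorphic sum there. -/
theorem differentiableAt_tsum_of_summable_bound {ι E : Type*} [NormedAddCommGroup E]
    [NormedSpace ℂ E] {F : ι → E → ℂ} {U : Set E} {u : ι → ℝ} (hU : IsOpen U) (hu : Summable u)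
    (hF : ∀ i, ∀ w ∈ U, DifferentiableAt ℂ (F i) w) (hle : ∀ i, ∀ w ∈ U, ‖F i w‖ ≤ u i)
    {x : E} (hx : x ∈ U) : DifferentiableAt ℂ (fun w => ∑' i, F i w) x := by
  obtain ⟨ε, hε, hball⟩ := Metric.isOpen_iff.1 hU x hx
  have hmem : ∀ z ∈ Metric.ball x (ε / 2), ∀ y, ‖y - z‖ ≤ ε / 4 → y ∈ U := by
    intro z hz y hy
    apply hball
    rw [Metric.mem_ball] at hz ⊢
    rw [← dist_eq_norm] at hy
    linarith [dist_triangle y z x]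
  let _ : NormedSpace ℝ E := NormedSpace.restrictScalars ℝ ℂ E
  -- Balls of radius `ε / 4` centred in `ball x (ε / 2)` stay in `U`, so Cauchy's estimate bounds
  -- the derivatives by the summable `u i / (ε / 4)`.
  exact (hasFDerivAt_tsum_of_isPreconnected (hu.div_const (ε / 4)) Metric.isOpen_ball
    (convex_ball x (ε / 2)).isPreconnected
    (fun n z hz => (hF n z (hmem z hz z (by simp; positivity))).hasFDerivAt)
    (fun n z hz => norm_fderiv_le_of_forall_mem_ball (by positivity)
      (fun y hy => hF n y (hmem z hz y hy)) (fun y hy => hle n y (hmem z hz y hy)))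
    (Metric.mem_ball_self (half_pos hε)) (hu.of_norm_bounded fun i => hle i x hx)
    (Metric.mem_ball_self (half_pos hε))).differentiableAt

/-! ### Euler-Maclaurin expansion on a unit interval -/

/-- The coefficient `s (s + 1) ⋯ (s + k - 1) / k!`. -/
noncomputable def risingBinom (k : ℕ) (s : ℂ) : ℂ :=
  ∏ i ∈ Finset.range k, (s + i) / (i + 1)

/-- The coefficients of the expansion of `∑_{m > n} m ^ (-s)` in the powers `n ^ (1 - s - k)`. -/
noncomputable def tailCoeff : ℕ → ℂ → ℂ
  | 0, s => (s - 1)⁻¹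
  | k + 1, s => risingBinom k s * (bernoulli (k + 1) : ℂ) / (k + 1)

/-- The integral remainder in the Euler-Maclaurin expansion on `[y, y + 1]`. -/
noncomputable def bernoulliIntegral (k : ℕ) (s : ℂ) (y : ℝ) : ℂ :=
  ∫ x in (0 : ℝ)..1, (bernoulliFun k x : ℂ) * ((y + x : ℝ) : ℂ) ^ (-s - k)

theorem differentiable_risingBinom (k : ℕ) : Differentiable ℂ (risingBinom k) := by
  unfold risingBinom
  fun_prop

theorem differentiableAt_tailCoeff (k : ℕ) {s : ℂ} (hs : s ≠ 1) :
    DifferentiableAt ℂ (tailCoeff k) s := by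
  cases k with
  | zero =>
    have : s - 1 ≠ 0 := sub_ne_zero.2 hs
    unfold tailCoeff
    fun_prop (disch := assumption)
  | succ k =>
    have := (differentiable_risingBinom k).differentiableAt (x := s)
    unfold tailCoeff
    fun_prop

theorem hasDerivAt_add_cpow {y : ℝ} (hy : 0 < y) {x : ℝ} (hx : 0 ≤ x) (w : ℂ) :
    HasDerivAt (fun x : ℝ => ((y + x : ℝ) : ℂ) ^ w) (w * ((y + x : ℝ) : ℂ) ^ (w - 1)) x := by
  have h2 : ((y + x : ℝ) : ℂ) ∈ Complex.slitPlane := Or.inl (by simp; positivity)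
  have h3 := (hasDerivAt_id ((y + x : ℝ) : ℂ)).cpow_const (c := w) h2
  simpa using h3.comp_ofReal.comp_const_add y x

theorem continuousOn_add_cpow {y : ℝ} (hy : 0 < y) (w : ℂ) :
    ContinuousOn (fun x : ℝ => ((y + x : ℝ) : ℂ) ^ w) (Set.uIcc 0 1) := fun x hx => by
  rw [Set.uIcc_of_le zero_le_one] at hx
  exact (hasDerivAt_add_cpow hy hx.1 w).continuousAt.continuousWithinAt

/-- Integration by parts, with B_{k+1}/(k+1) as antiderivative of B_k. -/
theorem bernoulliIntegral_eq_succ (k : ℕ) (s : ℂ) {y : ℝ} (hy : 0 < y) :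
    bernoulliIntegral k s y =
      ((bernoulliFun (k + 1) 1 : ℂ) * ((y + 1 : ℝ) : ℂ) ^ (-s - k) -
        (bernoulliFun (k + 1) 0 : ℂ) * (y : ℂ) ^ (-s - k)) / (k + 1) +
      (s + k) / (k + 1) * bernoulliIntegral (k + 1) s y := by
  have hk : (k : ℂ) + 1 ≠ 0 := Nat.cast_add_one_ne_zero k
  have hB : ∀ j : ℕ, ContinuousOn (fun x : ℝ => (bernoulliFun j x : ℂ)) (Set.uIcc 0 1) := fun j =>
    (Complex.continuous_ofReal.comp (continuous_bernoulliFun j)).continuousOn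
  have hd : ∀ x ∈ Set.uIcc (0 : ℝ) 1, HasDerivAt
      (fun x : ℝ => ((bernoulliFun (k + 1) x / (k + 1) : ℝ) : ℂ) * ((y + x : ℝ) : ℂ) ^ (-s - k))
      ((bernoulliFun k x : ℂ) * ((y + x : ℝ) : ℂ) ^ (-s - k) - (s + k) / (k + 1) *
        ((bernoulliFun (k + 1) x : ℂ) * ((y + x : ℝ) : ℂ) ^ (-s - (k + 1 : ℕ)))) x := by
    intro x hx
    rw [Set.uIcc_of_le zero_le_one] at hx
    have := (antideriv_bernoulliFun k x).ofReal_comp.mul (hasDerivAt_add_cpow hy hx.1 (-s - k))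
    convert! this using 1
    have : -s - ((k + 1 : ℕ) : ℂ) = -s - k - 1 := by push_cast; ring
    rw [this]
    push_cast
    field_simp
    ring
  have h1 : IntervalIntegrable
      (fun x : ℝ => (bernoulliFun k x : ℂ) * ((y + x : ℝ) : ℂ) ^ (-s - k))
      MeasureTheory.volume 0 1 := ((hB k).mul (continuousOn_add_cpow hy _)).intervalIntegrable
  have h2 : IntervalIntegrable (fun x : ℝ => (s + k) / (k + 1) *
        ((bernoulliFun (k + 1) x : ℂ) * ((y + x : ℝ) : ℂ) ^ (-s - (k + 1 : ℕ))))
      MeasureTheory.volume 0 1 :=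
    (continuousOn_const.mul ((hB _).mul (continuousOn_add_cpow hy _))).intervalIntegrable
  have := intervalIntegral.integral_eq_sub_of_hasDerivAt hd (h1.sub h2)
  rw [intervalIntegral.integral_sub h1 h2, intervalIntegral.integral_const_mul, sub_eq_iff_eq_add]
    at this
  simp only [bernoulliIntegral, this]
  push_cast
  rw [add_zero]
  ring

theorem bernoulliIntegral_zero {s : ℂ} (hs : s ≠ 1) {y : ℝ} (hy : 0 < y) :
    bernoulliIntegral 0 s y = (s - 1)⁻¹ * ((y : ℂ) ^ (1 - s) - ((y + 1 : ℝ) : ℂ) ^ (1 - s)) := by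
  have hs' : s - 1 ≠ 0 := sub_ne_zero.2 hs
  have hd : ∀ x ∈ Set.uIcc (0 : ℝ) 1, HasDerivAt
      (fun x : ℝ => -(s - 1)⁻¹ * ((y + x : ℝ) : ℂ) ^ (1 - s))
      ((bernoulliFun 0 x : ℂ) * ((y + x : ℝ) : ℂ) ^ (-s - (0 : ℕ))) x := by
    intro x hx
    rw [Set.uIcc_of_le zero_le_one] at hx
    convert! (hasDerivAt_add_cpow hy hx.1 (1 - s)).const_mul (-(s - 1)⁻¹) using 1
    have : 1 - s - 1 = -s := by ring
    simp [this]
    field_simp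
    try ring
  have h1 : IntervalIntegrable
      (fun x : ℝ => (bernoulliFun 0 x : ℂ) * ((y + x : ℝ) : ℂ) ^ (-s - (0 : ℕ)))
      MeasureTheory.volume 0 1 := by
    simp only [bernoulliFun_zero]
    exact (continuousOn_const.mul (continuousOn_add_cpow hy _)).intervalIntegrable
  rw [bernoulliIntegral, intervalIntegral.integral_eq_sub_of_hasDerivAt hd h1]
  push_cast
  rw [add_zero]
  ring

/-- Euler-Maclaurin expansion of the single term `(y + 1) ^ (-s)`. -/
theorem add_one_cpow_neg_eq (M : ℕ) {s : ℂ} (hs : s ≠ 1) {y : ℝ} (hy : 0 < y) :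
    ((y + 1 : ℝ) : ℂ) ^ (-s) - ∑ k ∈ Finset.range (M + 2), tailCoeff k s *
        ((y : ℂ) ^ (1 - s - k) - ((y + 1 : ℝ) : ℂ) ^ (1 - s - k)) =
      -(risingBinom (M + 1) s * bernoulliIntegral (M + 1) s y) := by
  -- In the base case B₁(1) = 1/2 and B₁(0) = -1/2 differ, which produces the term `(y + 1) ^ (-s)`.
  -- Afterwards B_j(0) = B_j(1), so each integration by parts adds one difference of powers.
  induction M with
  | zero =>
    have h := bernoulliIntegral_eq_succ 0 s hy
    rw [bernoulliIntegral_zero hs hy] at h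
    simp [bernoulliFun_one] at h
    have h1 : 1 - s - 1 = -s := by ring
    simp [tailCoeff, risingBinom, Finset.sum_range_succ, h, h1]
    ring
  | succ M ih =>
    rw [Finset.sum_range_succ, ← sub_sub, ih, bernoulliIntegral_eq_succ (M + 1) s hy,
      bernoulliFun_endpoints_eq_of_ne_one (by omega), bernoulliFun_eval_zero, tailCoeff,
      show risingBinom (M + 1 + 1) s = risingBinom (M + 1) s * ((s + (M + 1 : ℕ)) / ((M + 1 : ℕ) + 1))
        from Finset.prod_range_succ _ _]
    have hk : (M : ℂ) + 1 + 1 ≠ 0 := by exact_mod_cast Nat.succ_ne_zero (M + 1)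
    have : 1 - s - ((M + 1 + 1 : ℕ) : ℂ) = -s - (M + 1 : ℕ) := by push_cast; ring
    rw [this]
    push_cast
    field_simp
    ring

/-! ### Tails of the zeta series and decay of their remainders -/

/-- The analytic continuation in `s` of the tail `∑_{m > n + 1} m ^ (-s)`. -/
noncomputable def zetaTail (s : ℂ) (n : ℕ) : ℂ :=
  riemannZeta s - ∑ m ∈ Finset.range (n + 1), ((m : ℂ) + 1) ^ (-s)

/-- The remainder of `zetaTail` after `M` terms of its Euler-Maclaurin expansion. -/
noncomputable def tailRem (M : ℕ) (s : ℂ) (n : ℕ) : ℂ :=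
  zetaTail s n - ∑ k ∈ Finset.range M, tailCoeff k s * ((n : ℂ) + 1) ^ (1 - s - k)

theorem norm_natCast_add_one_cpow (n : ℕ) (s : ℂ) :
    ‖((n : ℂ) + 1) ^ s‖ = ((n : ℝ) + 1) ^ s.re := by
  have := Complex.norm_cpow_eq_rpow_re_of_pos (x := (n : ℝ) + 1) (by positivity) s
  simpa using this

theorem differentiable_natCast_add_one_cpow (n : ℕ) :
    Differentiable ℂ fun s : ℂ => ((n : ℂ) + 1) ^ s := fun _ =>
  differentiableAt_id.const_cpow (Or.inl (Nat.cast_add_one_ne_zero n))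

theorem differentiableAt_zetaTail (n : ℕ) {s : ℂ} (hs : s ≠ 1) :
    DifferentiableAt ℂ (fun s => zetaTail s n) s := by
  unfold zetaTail
  refine (differentiableAt_riemannZeta hs).sub (DifferentiableAt.fun_sum fun m _ => ?_)
  exact (differentiable_natCast_add_one_cpow m _).comp s differentiableAt_id.neg

theorem differentiableAt_tailRem (M n : ℕ) {s : ℂ} (hs : s ≠ 1) :
    DifferentiableAt ℂ (fun s => tailRem M s n) s := by
  unfold tailRem
  refine (differentiableAt_zetaTail n hs).sub (DifferentiableAt.fun_sum fun k _ => ?_)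
  refine (differentiableAt_tailCoeff k hs).mul ?_
  exact (differentiable_natCast_add_one_cpow n _).comp s (by fun_prop)

/-- Consecutive tails differ by the single term `(n + 2) ^ (-s)`, to which the expansion with `y = n
+ 1` applies. -/
theorem tailRem_sub_succ (M : ℕ) {s : ℂ} (hs : s ≠ 1) (n : ℕ) :
    tailRem (M + 2) s n - tailRem (M + 2) s (n + 1) =
      -(risingBinom (M + 1) s * bernoulliIntegral (M + 1) s (n + 1)) := by
  rw [← add_one_cpow_neg_eq M hs (by positivity)]
  simp only [tailRem, zetaTail, Finset.sum_range_succ _ (n + 1), mul_sub, Finset.sum_sub_distrib]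
  push_cast
  ring

/-- The sign condition makes the power decreasing on `[y, y + 1]`, so it is largest at `y`. -/
theorem exists_norm_bernoulliIntegral_le (k : ℕ) : ∃ B : ℝ, 0 ≤ B ∧ ∀ (s : ℂ) (y : ℝ), 0 < y →
    0 ≤ s.re + k → ‖bernoulliIntegral k s y‖ ≤ B * y ^ (-s.re - k) := by
  obtain ⟨B, hB⟩ := isCompact_Icc.exists_bound_of_continuousOn
    (continuous_bernoulliFun k).continuousOn (s := Set.Icc (0 : ℝ) 1)
  refine ⟨B, (norm_nonneg _).trans (hB 0 (by simp)), fun s y hy hs => ?_⟩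
  have hB0 : 0 ≤ B := (norm_nonneg _).trans (hB 0 (by simp))
  have := intervalIntegral.norm_integral_le_of_norm_le_const (a := 0) (b := 1)
    (f := fun x : ℝ => (bernoulliFun k x : ℂ) * ((y + x : ℝ) : ℂ) ^ (-s - k))
    (C := B * y ^ (-s.re - k)) (fun x hx => by
      rw [Set.uIoc_of_le zero_le_one] at hx
      have hyx : 0 < y + x := by linarith [hx.1]
      rw [norm_mul, Complex.norm_real, Complex.norm_cpow_eq_rpow_re_of_pos hyx]
      refine mul_le_mul (hB x ⟨hx.1.le, hx.2⟩) ?_ (by positivity) hB0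
      simpa using Real.rpow_le_rpow_of_nonpos (z := -s.re - k) hy (by linarith [hx.1])
        (by linarith))
  simpa [bernoulliIntegral] using this

/-- The punctured ball is a union of four convex slices, cut by im > 0, re > 1, im < 0 and re < 1;
`2 ≤ r` leaves room for the common points that link them. -/
theorem isPreconnected_ball_diff_one {r : ℝ} (hr : 2 ≤ r) :
    IsPreconnected (Metric.ball (0 : ℂ) r \ {1}) := by
  have hA := ((convex_ball (0 : ℂ) r).inter (convex_halfSpace_im_gt 0)).isPreconnected
  have hB := ((convex_ball (0 : ℂ) r).inter (convex_halfSpace_im_lt 0)).isPreconnected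
  have hC := ((convex_ball (0 : ℂ) r).inter (convex_halfSpace_re_gt 1)).isPreconnected
  have hD := ((convex_ball (0 : ℂ) r).inter (convex_halfSpace_re_lt 1)).isPreconnected
  have hp : ∀ a b : ℝ, a ^ 2 + b ^ 2 < 4 → (⟨a, b⟩ : ℂ) ∈ Metric.ball (0 : ℂ) r := by
    intro a b h
    rw [mem_ball_zero_iff, Complex.norm_eq_sqrt_sq_add_sq]
    refine lt_of_lt_of_le ?_ hr
    rw [Real.sqrt_lt' two_pos]
    simpa using h.trans_eq (by norm_num)
  have h1 := IsPreconnected.union (⟨3 / 2, 1 / 2⟩ : ℂ)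
    (by exact ⟨hp _ _ (by norm_num), by norm_num⟩) (by exact ⟨hp _ _ (by norm_num), by norm_num⟩)
    hA hC
  have h2 := IsPreconnected.union (⟨3 / 2, -1 / 2⟩ : ℂ)
    (by exact Or.inr ⟨hp _ _ (by norm_num), by norm_num⟩)
    (by exact ⟨hp _ _ (by norm_num), by norm_num⟩) h1 hB
  have h3 := IsPreconnected.union (⟨0, 1 / 2⟩ : ℂ)
    (by exact Or.inl (Or.inl ⟨hp _ _ (by norm_num), by norm_num⟩))
    (by exact ⟨hp _ _ (by norm_num), by norm_num⟩) h2 hD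
  convert! h3 using 1
  ext z
  simp only [Set.mem_sdiff, Set.mem_singleton_iff, Set.mem_union, Set.mem_inter_iff,
    Set.mem_ofPred_eq, Complex.ext_iff, Complex.one_re, Complex.one_im]
  grind

theorem summable_natCast_add_one_rpow {σ : ℝ} (hσ : 1 < σ) :
    Summable fun n : ℕ => ((n : ℝ) + 1) ^ (-σ) := by
  have := (summable_nat_add_iff 1).2 (Real.summable_nat_rpow.2 (neg_lt_neg hσ))
  simpa using this

theorem summable_natCast_add_one_cpow {s : ℂ} (hs : 1 < s.re) :
    Summable fun n : ℕ => ((n : ℂ) + 1) ^ (-s) := by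
  refine Summable.of_norm ?_
  simpa [norm_natCast_add_one_cpow] using summable_natCast_add_one_rpow hs

theorem riemannZeta_eq_tsum_cpow_neg {s : ℂ} (hs : 1 < s.re) :
    riemannZeta s = ∑' n : ℕ, ((n : ℂ) + 1) ^ (-s) := by
  rw [zeta_eq_tsum_one_div_nat_add_one_cpow hs]
  simp [Complex.cpow_neg]

theorem zetaTail_eq_tsum {s : ℂ} (hs : 1 < s.re) (n : ℕ) :
    zetaTail s n = ∑' m : ℕ, (((m + (n + 1) : ℕ) : ℂ) + 1) ^ (-s) := by
  rw [zetaTail, riemannZeta_eq_tsum_cpow_neg hs,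
    ← (summable_natCast_add_one_cpow hs).sum_add_tsum_nat_add (n + 1), add_sub_cancel_left]

theorem tendsto_natCast_add_one_cpow {w : ℂ} (hw : w.re < 0) :
    Tendsto (fun n : ℕ => ((n : ℂ) + 1) ^ w) atTop (𝓝 0) := by
  rw [tendsto_zero_iff_norm_tendsto_zero]
  simp only [norm_natCast_add_one_cpow]
  have h1 := (tendsto_rpow_neg_atTop (y := -w.re) (by linarith)).comp
    (tendsto_natCast_atTop_atTop.comp (tendsto_add_atTop_nat 1))
  simpa [Function.comp_def] using h1

theorem tendsto_tailRem {s : ℂ} (hs : 1 < s.re) (M : ℕ) :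
    Tendsto (fun n => tailRem M s n) atTop (𝓝 0) := by
  have h1 : Tendsto (fun n => zetaTail s n) atTop (𝓝 0) := by
    simp only [zetaTail_eq_tsum hs]
    exact (tendsto_sum_nat_add fun n : ℕ => ((n : ℂ) + 1) ^ (-s)).comp (tendsto_add_atTop_nat 1)
  have h2 : Tendsto (fun n : ℕ => ∑ k ∈ Finset.range M,
      tailCoeff k s * ((n : ℂ) + 1) ^ (1 - s - k)) atTop (𝓝 (∑ k ∈ Finset.range M, 0)) := by
    refine tendsto_finsetSum _ fun k _ => ?_
    have hk : (1 - s - k).re < 0 := by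
      simp only [Complex.sub_re, Complex.one_re, Complex.natCast_re]
      linarith [Nat.cast_nonneg (α := ℝ) k]
    simpa using (tendsto_natCast_add_one_cpow hk).const_mul (tailCoeff k s)
  simpa [tailRem] using h1.sub h2

/-- The remainder is the telescoping sum of its differences. For re s > 1 this holds because the
remainder tends to 0; the bounds on the differences make the sum holomorphic on the punctured ball,
and the identity theorem carries the equality there. -/
theorem exists_norm_tailRem_le_of_le {r : ℝ} (hr : 2 ≤ r) {M : ℕ} (hM : r + 1 ≤ M) :
    ∃ C : ℝ, 0 ≤ C ∧ ∀ s : ℂ, s ≠ 1 → ‖s‖ < r → ∀ n : ℕ,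
      ‖tailRem (M + 2) s n‖ ≤ C * ((n : ℝ) + 1) ^ (r + 1 - M) := by
  obtain ⟨B, hB0, hB⟩ := exists_norm_bernoulliIntegral_le (M + 1)
  obtain ⟨Q, hQ⟩ := (isCompact_closedBall (0 : ℂ) r).exists_bound_of_continuousOn
    (differentiable_risingBinom (M + 1)).continuous.continuousOn
  have hQ0 : 0 ≤ Q := (norm_nonneg _).trans (hQ 0 (by simp; linarith))
  set U := Metric.ball (0 : ℂ) r \ {1}
  have hUo : IsOpen U := Metric.isOpen_ball.sdiff isClosed_singleton
  have hne : ∀ s ∈ U, s ≠ 1 := fun s hs => hs.2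
  have hsum : Summable fun m : ℕ => ((m : ℝ) + 1) ^ (-2 : ℝ) :=
    summable_natCast_add_one_rpow one_lt_two
  have hstep : ∀ (n m : ℕ), ∀ s ∈ U,
      ‖tailRem (M + 2) s (n + m) - tailRem (M + 2) s (n + (m + 1))‖ ≤
        Q * B * ((n : ℝ) + 1) ^ (r + 1 - M) * ((m : ℝ) + 1) ^ (-2 : ℝ) := by
    intro n m s hs
    have hsr : ‖s‖ < r := by simpa using hs.1
    have hre := (abs_le.1 ((Complex.abs_re_le_norm s).trans hsr.le)).1
    have hy : (0 : ℝ) < (n + m : ℕ) + 1 := by positivity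
    have hy1 : (1 : ℝ) ≤ (n + m : ℕ) + 1 := by linarith [Nat.cast_nonneg (α := ℝ) (n + m)]
    rw [← add_assoc, tailRem_sub_succ M (hne s hs), norm_neg, norm_mul]
    have h1 := hB s _ hy (by push_cast; linarith)
    have h2 : (((n + m : ℕ) : ℝ) + 1) ^ (-s.re - (M + 1 : ℕ)) ≤
        ((n : ℝ) + 1) ^ (r + 1 - M) * ((m : ℝ) + 1) ^ (-2 : ℝ) := by
      -- As -re s ≤ r, the exponent is at most (r + 1 - M) - 2. The first part, nonpositive by `hM`,
      -- is charged to `n`; the -2 is charged to `m` for summability.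
      calc (((n + m : ℕ) : ℝ) + 1) ^ (-s.re - (M + 1 : ℕ))
          ≤ (((n + m : ℕ) : ℝ) + 1) ^ ((r + 1 - M) + (-2)) :=
            Real.rpow_le_rpow_of_exponent_le hy1 (by push_cast; linarith)
        _ = (((n + m : ℕ) : ℝ) + 1) ^ (r + 1 - M) * (((n + m : ℕ) : ℝ) + 1) ^ (-2 : ℝ) :=
            Real.rpow_add hy _ _
        _ ≤ _ := by
            refine mul_le_mul ?_ ?_ (by positivity) (by positivity)
            · exact Real.rpow_le_rpow_of_nonpos (by positivity) (by push_cast; simp) (by linarith)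
            · exact Real.rpow_le_rpow_of_nonpos (by positivity) (by push_cast; simp) (by norm_num)
    calc _ ≤ Q * (B * (((n + m : ℕ) : ℝ) + 1) ^ (-s.re - (M + 1 : ℕ))) :=
          mul_le_mul (hQ s (by simpa using hsr.le)) h1 (norm_nonneg _) hQ0
      _ ≤ Q * (B * (((n : ℝ) + 1) ^ (r + 1 - M) * ((m : ℝ) + 1) ^ (-2 : ℝ))) := by gcongr
      _ = _ := by ring
  have htsum : ∀ n : ℕ, Set.EqOn (fun s => tailRem (M + 2) s n) (fun s => ∑' m : ℕ,
      (tailRem (M + 2) s (n + m) - tailRem (M + 2) s (n + (m + 1)))) U := by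
    intro n
    have hL : DifferentiableOn ℂ (fun s => tailRem (M + 2) s n) U := fun s hs =>
      (differentiableAt_tailRem _ n (hne s hs)).differentiableWithinAt
    have hR : DifferentiableOn ℂ (fun s => ∑' m : ℕ,
        (tailRem (M + 2) s (n + m) - tailRem (M + 2) s (n + (m + 1)))) U := fun s hs =>
      (differentiableAt_tsum_of_summable_bound hUo (hsum.mul_left _)
        (fun m w hw => (differentiableAt_tailRem _ _ (hne w hw)).sub
          (differentiableAt_tailRem _ _ (hne w hw))) (hstep n) hs).differentiableWithinAt
    have h0 : (3 / 2 : ℂ) ∈ U := by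
      refine ⟨?_, by norm_num⟩
      rw [mem_ball_zero_iff]
      norm_num
      linarith
    refine (hL.analyticOnNhd hUo).eqOn_of_preconnected_of_eventuallyEq (hR.analyticOnNhd hUo)
      (isPreconnected_ball_diff_one hr) h0 ?_
    have h1 : ∀ᶠ s : ℂ in 𝓝 (3 / 2), 1 < s.re :=
      (isOpen_lt continuous_const Complex.continuous_re).eventually_mem
        (by norm_num)
    filter_upwards [h1, hUo.eventually_mem h0] with s hs hsU
    have hS : Summable fun m : ℕ =>
        tailRem (M + 2) s (n + m) - tailRem (M + 2) s (n + (m + 1)) :=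
      (hsum.mul_left _).of_norm_bounded fun m => hstep n m s hsU
    refine (HasSum.tsum_eq ?_).symm
    rw [hS.hasSum_iff_tendsto_nat]
    simp only [Finset.sum_range_sub' fun m => tailRem (M + 2) s (n + m)]
    simpa [add_comm] using ((tendsto_tailRem hs (M + 2)).comp (tendsto_add_atTop_nat n)).const_sub
      (tailRem (M + 2) s n)
  refine ⟨Q * B * ∑' m : ℕ, ((m : ℝ) + 1) ^ (-2 : ℝ), by positivity, fun s hs1 hsr n => ?_⟩
  have hs : s ∈ U := ⟨by simpa using hsr, hs1⟩
  rw [show tailRem (M + 2) s n = _ from htsum n hs]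
  refine (tsum_of_norm_bounded (hsum.mul_left _).hasSum fun m => hstep n m s hs).trans_eq ?_
  rw [tsum_mul_left]
  ring

/-- The remainder of the Euler-Maclaurin expansion decays as fast as desired, uniformly on
bounded sets of `s`. -/
theorem exists_norm_tailRem_le (r A : ℝ) : ∃ M₀ : ℕ, ∀ M ≥ M₀, ∃ C : ℝ, 0 ≤ C ∧ ∀ s : ℂ, s ≠ 1 →
    ‖s‖ ≤ r → ∀ n : ℕ, ‖tailRem M s n‖ ≤ C * ((n : ℝ) + 1) ^ (-A) := by
  set r' := max (r + 1) 2
  obtain ⟨N, hN⟩ := exists_nat_ge (r' + 1 + |A|)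
  refine ⟨N + 2, fun M hM => ?_⟩
  obtain ⟨K, rfl⟩ := Nat.exists_eq_add_of_le' (show 2 ≤ M by omega)
  have hK : r' + 1 + |A| ≤ K := hN.trans (by exact_mod_cast (by omega : N ≤ K))
  obtain ⟨C, hC0, hC⟩ := exists_norm_tailRem_le_of_le (le_max_right (r + 1) 2)
    (M := K) (by linarith [abs_nonneg A])
  refine ⟨C, hC0, fun s hs1 hs n => (hC s hs1 ?_ n).trans ?_⟩
  · linarith [le_max_left (r + 1) 2]
  · gcongr
    · simp
    · linarith [neg_abs_le A, le_abs_self A]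

/-! ### Continuation of Dirichlet series weighted by zeta tails -/

/-- The sum `∑ a n p * (n + 1) ^ (-s) * zetaTail s' n`, with `M` terms of the expansion of
`zetaTail s' n` summed by means of the Dirichlet series `D` of `a`. -/
noncomputable def tailSumApprox (a : ℕ → ℂ → ℂ) (D : ℂ × ℂ → ℂ) (M : ℕ) (x : ℂ × ℂ × ℂ) : ℂ :=
  ∑ k ∈ Finset.range M, tailCoeff k x.2.2 * D (x.1, x.2.1 + x.2.2 + k - 1) +
    ∑' n : ℕ, a n x.1 * ((n : ℂ) + 1) ^ (-x.2.1) * tailRem M x.2.2 n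

theorem cpow_neg_mul_cpow_one_sub (n k : ℕ) (s s' : ℂ) :
    ((n : ℂ) + 1) ^ (-s) * ((n : ℂ) + 1) ^ (1 - s' - k) = ((n : ℂ) + 1) ^ (-(s + s' + k - 1)) := by
  rw [← Complex.cpow_add _ _ (Nat.cast_add_one_ne_zero n)]
  congr 1
  ring

theorem exists_summable_bound_tailRem {a : ℕ → ℂ → ℂ}
    (hgrow : ∀ r : ℝ, ∃ A C : ℝ, 0 ≤ C ∧ ∀ p, ‖p‖ ≤ r → ∀ n : ℕ, ‖a n p‖ ≤ C * ((n : ℝ) + 1) ^ A)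
    (r : ℝ) : ∃ M₀ : ℕ, ∀ M ≥ M₀, ∃ u : ℕ → ℝ, Summable u ∧ ∀ x : ℂ × ℂ × ℂ, ‖x‖ ≤ r →
      x.2.2 ≠ 1 → ∀ n, ‖a n x.1 * ((n : ℂ) + 1) ^ (-x.2.1) * tailRem M x.2.2 n‖ ≤ u n := by
  obtain ⟨A, C, hC0, hC⟩ := hgrow r
  -- The coefficient costs the exponent `A` and the power at most `r`, which leaves -2 in total.
  obtain ⟨M₀, hM₀⟩ := exists_norm_tailRem_le r (A + r + 2)
  refine ⟨M₀, fun M hM => ?_⟩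
  obtain ⟨C', hC'0, hC'⟩ := hM₀ M hM
  refine ⟨fun n => C * C' * ((n : ℝ) + 1) ^ (-2 : ℝ),
    (summable_natCast_add_one_rpow one_lt_two).mul_left _, fun x hx hx1 n => ?_⟩
  have h1 : ‖x.1‖ ≤ r := (norm_fst_le x).trans hx
  have h2 : ‖x.2.1‖ ≤ r := ((norm_fst_le x.2).trans (norm_snd_le x)).trans hx
  have h3 : ‖x.2.2‖ ≤ r := ((norm_snd_le x.2).trans (norm_snd_le x)).trans hx
  have hre := (abs_le.1 ((Complex.abs_re_le_norm _).trans h2)).1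
  have hn : (0 : ℝ) < (n : ℝ) + 1 := by positivity
  rw [norm_mul, norm_mul, norm_natCast_add_one_cpow]
  calc ‖a n x.1‖ * ((n : ℝ) + 1) ^ (-x.2.1).re * ‖tailRem M x.2.2 n‖
      ≤ (C * ((n : ℝ) + 1) ^ A) * ((n : ℝ) + 1) ^ r * (C' * ((n : ℝ) + 1) ^ (-(A + r + 2))) := by
        gcongr
        · exact hC _ h1 n
        · simp
        · simp only [Complex.neg_re]; linarith
        · exact hC' _ hx1 h3 n
    _ = C * C' * (((n : ℝ) + 1) ^ A * ((n : ℝ) + 1) ^ r * ((n : ℝ) + 1) ^ (-(A + r + 2))) := by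
        ring
    _ = C * C' * ((n : ℝ) + 1) ^ (-2 : ℝ) := by
        rw [← Real.rpow_add hn, ← Real.rpow_add hn]
        congr 2
        ring

/-- One more expansion term moves from the remainder series into the finite sum. Hence the
approximation does not depend on `M` once `M` is large, which allows gluing. -/
theorem tailSumApprox_succ {a : ℕ → ℂ → ℂ} {D : ℂ × ℂ → ℂ} {M : ℕ} {x : ℂ × ℂ × ℂ}
    (hM : Summable fun n => a n x.1 * ((n : ℂ) + 1) ^ (-x.2.1) * tailRem M x.2.2 n)
    (hD : HasSum (fun n => a n x.1 * ((n : ℂ) + 1) ^ (-(x.2.1 + x.2.2 + M - 1)))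
      (D (x.1, x.2.1 + x.2.2 + M - 1))) :
    tailSumApprox a D (M + 1) x = tailSumApprox a D M x := by
  have h := hM.hasSum.sub (hD.mul_left (tailCoeff M x.2.2))
  have heq : ∀ n, a n x.1 * ((n : ℂ) + 1) ^ (-x.2.1) * tailRem (M + 1) x.2.2 n =
      a n x.1 * ((n : ℂ) + 1) ^ (-x.2.1) * tailRem M x.2.2 n -
        tailCoeff M x.2.2 * (a n x.1 * ((n : ℂ) + 1) ^ (-(x.2.1 + x.2.2 + M - 1))) := fun n => by
    rw [tailRem, tailRem, Finset.sum_range_succ, ← cpow_neg_mul_cpow_one_sub]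
    ring
  simp only [tailSumApprox, heq]
  rw [h.tsum_eq, Finset.sum_range_succ]
  ring

theorem tailSumApprox_eq_tsum {a : ℕ → ℂ → ℂ} {D : ℂ × ℂ → ℂ} {M : ℕ} {x : ℂ × ℂ × ℂ}
    (hM : Summable fun n => a n x.1 * ((n : ℂ) + 1) ^ (-x.2.1) * tailRem M x.2.2 n)
    (hD : ∀ k : ℕ, HasSum (fun n => a n x.1 * ((n : ℂ) + 1) ^ (-(x.2.1 + x.2.2 + k - 1)))
      (D (x.1, x.2.1 + x.2.2 + k - 1))) :
    tailSumApprox a D M x = ∑' n : ℕ, a n x.1 * ((n : ℂ) + 1) ^ (-x.2.1) * zetaTail x.2.2 n := by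
  have h := (hasSum_sum (s := Finset.range M) fun k _ =>
    (hD k).mul_left (tailCoeff k x.2.2)).add hM.hasSum
  rw [tailSumApprox, ← h.tsum_eq]
  refine tsum_congr fun n => ?_
  simp only [tailRem, ← cpow_neg_mul_cpow_one_sub, mul_sub, Finset.mul_sum]
  rw [add_comm, sub_add_eq_add_sub, sub_eq_iff_eq_add]
  congr 1
  exact Finset.sum_congr rfl fun k _ => by ring

/-- If the Dirichlet series `∑ a n p * (n + 1) ^ (-s)` continues to a function `D` that is
holomorphic on `V`, then `∑ a n p * (n + 1) ^ (-s) * ∑_{m > n + 1} m ^ (-s')` continues to the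
points with `s' ≠ 1` and `(p, s + s' + k - 1) ∈ V` for all `k`. -/
theorem exists_continuation_tsum_mul_zetaTail {a : ℕ → ℂ → ℂ} (ha : ∀ n, Differentiable ℂ (a n))
    (hgrow : ∀ r : ℝ, ∃ A C : ℝ, 0 ≤ C ∧ ∀ p, ‖p‖ ≤ r → ∀ n : ℕ, ‖a n p‖ ≤ C * ((n : ℝ) + 1) ^ A)
    {D : ℂ × ℂ → ℂ} {V V₀ : Set (ℂ × ℂ)} (hD : ∀ x ∈ V, DifferentiableAt ℂ D x)
    (hV₀ : ∀ x ∈ V₀, HasSum (fun n => a n x.1 * ((n : ℂ) + 1) ^ (-x.2)) (D x))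
    (hbig : ∀ r : ℝ, ∃ σ : ℝ, ∀ p s : ℂ, ‖p‖ ≤ r → σ < s.re → (p, s) ∈ V₀) :
    ∃ W : ℂ × ℂ × ℂ → ℂ,
      (∀ p s s' : ℂ, s' ≠ 1 → (∀ k : ℕ, (p, s + s' + k - 1) ∈ V) →
        DifferentiableAt ℂ W (p, s, s')) ∧
      (∀ p s s' : ℂ, s' ≠ 1 → (∀ k : ℕ, (p, s + s' + k - 1) ∈ V₀) →
        W (p, s, s') = ∑' n : ℕ, a n p * ((n : ℂ) + 1) ^ (-s) * zetaTail s' n) := by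
  have key : ∀ r : ℕ, ∃ M₀ : ℕ, ∀ M ≥ M₀, (∃ u : ℕ → ℝ, Summable u ∧ ∀ x : ℂ × ℂ × ℂ, ‖x‖ ≤ r →
      x.2.2 ≠ 1 → ∀ n, ‖a n x.1 * ((n : ℂ) + 1) ^ (-x.2.1) * tailRem M x.2.2 n‖ ≤ u n) ∧
      ∀ x : ℂ × ℂ × ℂ, ‖x‖ ≤ r → (x.1, x.2.1 + x.2.2 + M - 1) ∈ V₀ := by
    intro r
    obtain ⟨M₁, hM₁⟩ := exists_summable_bound_tailRem hgrow r
    obtain ⟨σ, hσ⟩ := hbig r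
    obtain ⟨M₂, hM₂⟩ := exists_nat_gt (σ + 2 * r + 1)
    refine ⟨max M₁ M₂, fun M hM => ⟨hM₁ M (le_of_max_le_left hM), fun x hx => ?_⟩⟩
    have h1 : ‖x.1‖ ≤ r := (norm_fst_le x).trans hx
    have h2 : ‖x.2.1‖ ≤ r := ((norm_fst_le x.2).trans (norm_snd_le x)).trans hx
    have h3 : ‖x.2.2‖ ≤ r := ((norm_snd_le x.2).trans (norm_snd_le x)).trans hx
    have h2' := (abs_le.1 ((Complex.abs_re_le_norm _).trans h2)).1
    have h3' := (abs_le.1 ((Complex.abs_re_le_norm _).trans h3)).1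
    have hMM : (M₂ : ℝ) ≤ M := by exact_mod_cast le_of_max_le_right hM
    refine hσ _ _ h1 ?_
    simp only [Complex.sub_re, Complex.add_re, Complex.natCast_re, Complex.one_re]
    linarith
  choose N hN using key
  have hsummable : ∀ (r M : ℕ), N r ≤ M → ∀ x : ℂ × ℂ × ℂ, ‖x‖ ≤ r → x.2.2 ≠ 1 →
      Summable fun n => a n x.1 * ((n : ℂ) + 1) ^ (-x.2.1) * tailRem M x.2.2 n := by
    intro r M hM x hx hx1
    obtain ⟨u, hu, hle⟩ := (hN r M hM).1
    exact hu.of_norm_bounded (hle x hx hx1)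
  have hstable : ∀ (r M : ℕ), N r ≤ M → ∀ x : ℂ × ℂ × ℂ, ‖x‖ ≤ r → x.2.2 ≠ 1 →
      tailSumApprox a D M x = tailSumApprox a D (N r) x := by
    intro r M hM x hx hx1
    induction M, hM using Nat.le_induction with
    | base => rfl
    | succ M hM ih =>
      rw [tailSumApprox_succ (hsummable r M hM x hx hx1) (hV₀ _ ((hN r M hM).2 x hx)), ih]
  have hW : ∀ (r : ℕ) (x : ℂ × ℂ × ℂ), ‖x‖ ≤ r → x.2.2 ≠ 1 →
      tailSumApprox a D (N ⌈‖x‖⌉₊) x = tailSumApprox a D (N r) x := fun r x hx hx1 =>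
    (hstable _ (max (N ⌈‖x‖⌉₊) (N r)) (le_max_left _ _) x (Nat.le_ceil _) hx1).symm.trans
      (hstable _ _ (le_max_right _ _) x hx hx1)
  -- The number of terms grows with `‖x‖`; by `hW` it may be frozen at `N r` on a bounded set, so
  -- the function is locally one fixed expression.
  refine ⟨fun x => tailSumApprox a D (N ⌈‖x‖⌉₊) x, fun p s s' hs' hV => ?_, fun p s s' hs' h => ?_⟩
  · obtain ⟨r, hr⟩ := exists_nat_gt ‖(p, s, s')‖
    set U : Set (ℂ × ℂ × ℂ) := {x | ‖x‖ < r} ∩ {x | x.2.2 ≠ 1}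
    have hUo : IsOpen U := (isOpen_lt continuous_norm continuous_const).inter
      (isOpen_ne_fun (by fun_prop) continuous_const)
    have hxU : (p, s, s') ∈ U := ⟨hr, hs'⟩
    have hev : (fun x => tailSumApprox a D (N ⌈‖x‖⌉₊) x) =ᶠ[𝓝 (p, s, s')]
        tailSumApprox a D (N r) := by
      filter_upwards [hUo.eventually_mem hxU] with x hx using hW r x hx.1.le hx.2
    refine DifferentiableAt.congr_of_eventuallyEq ?_ hev
    obtain ⟨u, hu, hle⟩ := (hN r (N r) le_rfl).1
    have hd1 : ∀ k : ℕ, DifferentiableAt ℂ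
        (fun x : ℂ × ℂ × ℂ => tailCoeff k x.2.2 * D (x.1, x.2.1 + x.2.2 + k - 1)) (p, s, s') := by
      intro k
      have e1 : DifferentiableAt ℂ (fun x : ℂ × ℂ × ℂ => tailCoeff k x.2.2) (p, s, s') :=
        DifferentiableAt.comp (p, s, s') (f := fun x : ℂ × ℂ × ℂ => x.2.2)
          (differentiableAt_tailCoeff k hs') (by fun_prop)
      have e2 : DifferentiableAt ℂ (fun x : ℂ × ℂ × ℂ => D (x.1, x.2.1 + x.2.2 + k - 1))
          (p, s, s') :=
        DifferentiableAt.comp (p, s, s')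
          (f := fun x : ℂ × ℂ × ℂ => (x.1, x.2.1 + x.2.2 + (k : ℂ) - 1)) (hD _ (hV k))
          (by fun_prop)
      exact e1.mul e2
    have hd2 : ∀ n : ℕ, ∀ x ∈ U, DifferentiableAt ℂ (fun x : ℂ × ℂ × ℂ =>
        a n x.1 * ((n : ℂ) + 1) ^ (-x.2.1) * tailRem (N r) x.2.2 n) x := by
      intro n x hx
      have e1 : DifferentiableAt ℂ (fun x : ℂ × ℂ × ℂ => a n x.1) x :=
        DifferentiableAt.comp x (f := fun x : ℂ × ℂ × ℂ => x.1) (ha n _) (by fun_prop)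
      have e2 : DifferentiableAt ℂ (fun x : ℂ × ℂ × ℂ => ((n : ℂ) + 1) ^ (-x.2.1)) x :=
        DifferentiableAt.comp x (f := fun x : ℂ × ℂ × ℂ => -x.2.1)
          (differentiable_natCast_add_one_cpow n _) (by fun_prop)
      have e3 : DifferentiableAt ℂ (fun x : ℂ × ℂ × ℂ => tailRem (N r) x.2.2 n) x :=
        DifferentiableAt.comp x (f := fun x : ℂ × ℂ × ℂ => x.2.2)
          (differentiableAt_tailRem (N r) n hx.2) (by fun_prop)
      exact (e1.mul e2).mul e3
    exact (DifferentiableAt.fun_sum fun k _ => hd1 k).add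
      (differentiableAt_tsum_of_summable_bound hUo hu hd2
        (fun n x hx => hle x hx.1.le hx.2 n) hxU)
  · exact tailSumApprox_eq_tsum (hsummable _ _ le_rfl (p, s, s') (Nat.le_ceil _) hs')
      fun k => hV₀ _ (h k)

/-! ### The double and triple zeta functions -/

/-- The partial sums of the Dirichlet series of the Riemann zeta function. -/
noncomputable def zetaPartialSum (n : ℕ) (p : ℂ) : ℂ :=
  ∑ m ∈ Finset.range n, ((m : ℂ) + 1) ^ (-p)

theorem differentiable_zetaPartialSum (n : ℕ) : Differentiable ℂ (zetaPartialSum n) := by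
  unfold zetaPartialSum
  exact Differentiable.fun_sum fun m _ =>
    (differentiable_natCast_add_one_cpow m).comp differentiable_neg

theorem norm_zetaPartialSum_le {r : ℝ} {p : ℂ} (hp : ‖p‖ ≤ r) (n : ℕ) :
    ‖zetaPartialSum n p‖ ≤ 1 * ((n : ℝ) + 1) ^ (r + 1) := by
  have hr : 0 ≤ r := (norm_nonneg p).trans hp
  have hre := (abs_le.1 ((Complex.abs_re_le_norm _).trans hp)).1
  have h : ∀ m ∈ Finset.range n, ‖((m : ℂ) + 1) ^ (-p)‖ ≤ ((n : ℝ) + 1) ^ r := fun m hm => by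
    rw [norm_natCast_add_one_cpow]
    have hmn : (m : ℝ) ≤ n := by exact_mod_cast (Finset.mem_range.1 hm).le
    calc ((m : ℝ) + 1) ^ (-p).re ≤ ((m : ℝ) + 1) ^ r :=
          Real.rpow_le_rpow_of_exponent_le (by simp) (by simp only [Complex.neg_re]; linarith)
      _ ≤ _ := by gcongr
  have h1 := norm_sum_le_of_le _ h
  rw [Finset.sum_const, Finset.card_range, nsmul_eq_mul] at h1
  rw [one_mul, Real.rpow_add_one (by positivity), mul_comm]
  exact h1.trans (by gcongr; simp)

/-- Since `x ≤ y`, the excess decay in `y` beyond `1 + δ` can be transferred to `x`. This dominates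
a sum over m < n by a product of two convergent series. -/
theorem rpow_neg_mul_rpow_neg_le {x y p σ δ : ℝ} (hx : 0 < x) (hx1 : 1 ≤ x) (hxy : x ≤ y)
    (hσ : δ < σ - 1) (hp : 2 + 2 * δ ≤ p + σ) :
    x ^ (-p) * y ^ (-σ) ≤ y ^ (-(1 + δ)) * x ^ (-(1 + δ)) := by
  have hy : 0 < y := hx.trans_le hxy
  calc x ^ (-p) * y ^ (-σ) = x ^ (-p) * (y ^ (-(1 + δ)) * y ^ (-(σ - 1 - δ))) := by
        rw [← Real.rpow_add hy]; congr 2; ring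
    _ ≤ x ^ (-p) * (y ^ (-(1 + δ)) * x ^ (-(σ - 1 - δ))) := by
        have := Real.rpow_le_rpow_of_nonpos (z := -(σ - 1 - δ)) hx hxy (by linarith)
        gcongr
    _ = y ^ (-(1 + δ)) * x ^ (-p + -(σ - 1 - δ)) := by rw [Real.rpow_add hx]; ring
    _ ≤ _ := by
        gcongr
        linarith

theorem summable_ite_lt_cpow_mul {p : ℂ} {b : ℕ → ℂ} {C σ : ℝ} (hσ : 1 < σ) (hp : 2 < p.re + σ)
    (hb : ∀ n, ‖b n‖ ≤ C * ((n : ℝ) + 1) ^ (-σ)) :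
    Summable fun x : ℕ × ℕ => if x.2 < x.1 then ((x.2 : ℂ) + 1) ^ (-p) * b x.1 else 0 := by
  have hC : 0 ≤ C := by simpa using (norm_nonneg _).trans (hb 0)
  obtain ⟨δ, hδ, hδ'⟩ := exists_between (show 0 < min (σ - 1) ((p.re + σ - 2) / 2) by
    rw [lt_min_iff]; constructor <;> linarith)
  rw [lt_min_iff] at hδ'
  have hsum := summable_natCast_add_one_rpow (show 1 < 1 + δ by linarith)
  refine ((hsum.mul_of_nonneg hsum (fun _ => by positivity)
    (fun _ => by positivity)).mul_left C).of_norm_bounded ?_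
  rintro ⟨n, m⟩
  dsimp only
  split_ifs with hmn
  · rw [norm_mul, norm_natCast_add_one_cpow, Complex.neg_re]
    have hmn' : (m : ℝ) + 1 ≤ (n : ℝ) + 1 := by
      have : (m : ℝ) ≤ n := by exact_mod_cast hmn.le
      linarith
    have := rpow_neg_mul_rpow_neg_le (p := p.re) (σ := σ) (δ := δ)
      (by positivity : (0 : ℝ) < (m : ℝ) + 1) (by simp) hmn' hδ'.1 (by linarith)
    calc ((m : ℝ) + 1) ^ (-p.re) * ‖b n‖
        ≤ ((m : ℝ) + 1) ^ (-p.re) * (C * ((n : ℝ) + 1) ^ (-σ)) :=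
          mul_le_mul_of_nonneg_left (hb n) (by positivity)
      _ = C * (((m : ℝ) + 1) ^ (-p.re) * ((n : ℝ) + 1) ^ (-σ)) := by ring
      _ ≤ _ := mul_le_mul_of_nonneg_left this hC
  · rw [norm_zero]; positivity

/-- Fubini on the region m < n, justified by absolute convergence. -/
theorem hasSum_zetaPartialSum_mul {p : ℂ} {b : ℕ → ℂ} {C σ : ℝ} (hσ : 1 < σ) (hp : 2 < p.re + σ)
    (hb : ∀ n, ‖b n‖ ≤ C * ((n : ℝ) + 1) ^ (-σ)) :
    HasSum (fun n => zetaPartialSum n p * b n)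
      (∑' m : ℕ, ((m : ℂ) + 1) ^ (-p) * ∑' j : ℕ, b (j + (m + 1))) := by
  have hf := summable_ite_lt_cpow_mul hσ hp hb
  have h1 : ∀ n : ℕ, ∑' m : ℕ, (if m < n then ((m : ℂ) + 1) ^ (-p) * b n else 0) =
      zetaPartialSum n p * b n := fun n => by
    rw [tsum_eq_sum (s := Finset.range n) fun m hm => by simp_all, zetaPartialSum,
      Finset.sum_mul]
    exact Finset.sum_congr rfl fun m hm => if_pos (Finset.mem_range.1 hm)
  have h2 : ∀ m : ℕ, ∑' n : ℕ, (if m < n then ((m : ℂ) + 1) ^ (-p) * b n else 0) =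
      ((m : ℂ) + 1) ^ (-p) * ∑' j : ℕ, b (j + (m + 1)) := fun m => by
    have hs := hf.prod_symm.prod_factor m
    dsimp only [Prod.swap_prod_mk, Prod.fst, Prod.snd] at hs
    rw [← hs.sum_add_tsum_nat_add (m + 1), Finset.sum_eq_zero, zero_add, ← tsum_mul_left]
    · exact tsum_congr fun j => if_pos (by omega)
    · intro n hn
      exact if_neg (by simpa [Nat.lt_succ_iff] using hn)
  have h3 := hf.prod.hasSum
  have h4 := hf.tsum_comm (f := fun n m : ℕ => if m < n then ((m : ℂ) + 1) ^ (-p) * b n else 0)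
  simp only [h1, h2] at h3 h4
  rwa [h4]

theorem exists_norm_zetaTail_le {s : ℂ} {δ : ℝ} (hδ : 0 < δ) (hs : 1 + δ ≤ s.re) :
    ∃ C : ℝ, ∀ n : ℕ, ‖zetaTail s n‖ ≤ C * ((n : ℝ) + 1) ^ (-(s.re - 1 - δ)) := by
  have hsum := summable_natCast_add_one_rpow (show 1 < 1 + δ by linarith)
  refine ⟨∑' m : ℕ, ((m : ℝ) + 1) ^ (-(1 + δ)), fun n => ?_⟩
  rw [zetaTail_eq_tsum (by linarith), ← tsum_mul_right]
  refine tsum_of_norm_bounded (hsum.mul_right _).hasSum fun m => ?_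
  rw [norm_natCast_add_one_cpow, Complex.neg_re]
  calc (((m + (n + 1) : ℕ) : ℝ) + 1) ^ (-s.re)
      = (((m + (n + 1) : ℕ) : ℝ) + 1) ^ (-(1 + δ)) *
          (((m + (n + 1) : ℕ) : ℝ) + 1) ^ (-(s.re - 1 - δ)) := by
        rw [← Real.rpow_add (by positivity)]; congr 1; ring
    _ ≤ _ := by
        refine mul_le_mul ?_ ?_ (by positivity) (by positivity)
        · exact Real.rpow_le_rpow_of_nonpos (by positivity)
            (by push_cast; linarith [Nat.cast_nonneg (α := ℝ) n]) (by linarith)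
        · exact Real.rpow_le_rpow_of_nonpos (by positivity)
            (by push_cast; linarith [Nat.cast_nonneg (α := ℝ) m]) (by linarith)

/-- The analytic continuation of the double zeta function. -/
theorem exists_doubleZeta : ∃ D : ℂ × ℂ → ℂ,
    (∀ s₁ s₂ : ℂ, s₂ ≠ 1 → (∀ l : ℕ, s₁ + s₂ ≠ 2 - l) → DifferentiableAt ℂ D (s₁, s₂)) ∧
    ∀ s₁ s₂ : ℂ, s₂ ≠ 1 → 2 < (s₁ + s₂).re →
      D (s₁, s₂) = ∑' n : ℕ, ((n : ℂ) + 1) ^ (-s₁) * zetaTail s₂ n := by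
  -- The coefficients are constant, so the parameter `p` is a dummy, set to 0 below.
  obtain ⟨W, hW, hW'⟩ := exists_continuation_tsum_mul_zetaTail (a := fun _ _ => 1)
    (D := fun x => riemannZeta x.2) (V := {x | x.2 ≠ 1}) (V₀ := {x | 1 < x.2.re})
    (fun _ => differentiable_const _) (fun r => ⟨0, 1, zero_le_one, fun p _ n => by simp⟩)
    (fun x hx => DifferentiableAt.comp x (f := fun x : ℂ × ℂ => x.2)
      (differentiableAt_riemannZeta hx) (by fun_prop))
    (fun x hx => by
      rw [riemannZeta_eq_tsum_cpow_neg hx]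
      simpa using (summable_natCast_add_one_cpow hx).hasSum)
    (fun r => ⟨1, fun p s _ hs => hs⟩)
  refine ⟨fun x => W (0, x.1, x.2), fun s₁ s₂ hs hl => ?_, fun s₁ s₂ hs h2 => ?_⟩
  · refine DifferentiableAt.comp (s₁, s₂) (f := fun x : ℂ × ℂ => ((0 : ℂ), x.1, x.2))
      (hW 0 s₁ s₂ hs fun k hk => hl k ?_) (by fun_prop)
    linear_combination hk
  · have := hW' 0 s₁ s₂ hs fun k => by
      have := Nat.cast_nonneg (α := ℝ) k
      simp at h2 ⊢
      linarith
    simpa using this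

/-- The double zeta function is thus the Dirichlet series whose coefficients are the partial sums,
the input needed for the triple one. -/
theorem hasSum_zetaPartialSum_mul_cpow {s₁ s₂ : ℂ} (h2 : 1 < s₂.re) (h12 : 2 < (s₁ + s₂).re) :
    HasSum (fun n => zetaPartialSum n s₁ * ((n : ℂ) + 1) ^ (-s₂))
      (∑' n : ℕ, ((n : ℂ) + 1) ^ (-s₁) * zetaTail s₂ n) := by
  simp only [zetaTail_eq_tsum h2]
  exact hasSum_zetaPartialSum_mul (C := 1) h2 (by simpa using h12)
    (b := fun n => ((n : ℂ) + 1) ^ (-s₂)) fun n => by simp [norm_natCast_add_one_cpow]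

theorem tsum_Ici_eq (f : ℕ → ℂ) (N : ℕ) : ∑' n : Set.Ici N, f n = ∑' j : ℕ, f (j + N) := by
  rw [tsum_subtype (Set.Ici N) f, ← (add_left_injective N).tsum_eq]
  · exact tsum_congr fun j => by simp
  · intro n hn
    have : N ≤ n := by
      by_contra h
      simp [h] at hn
    exact ⟨n - N, by simp [this]⟩

theorem tsum_Ioi_eq (f : ℕ → ℂ) (N : ℕ) :
    ∑' n : Set.Ioi N, f n = ∑' j : ℕ, f (j + (N + 1)) :=
  tsum_Ici_eq f (N + 1)

theorem tripleZetaSeries_eq {s₁ s₂ s₃ : ℂ} (h1 : 1 ≤ s₁.re) (h2 : 1 ≤ s₂.re) (h3 : 1 < s₃.re) :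
    tripleZetaSeries s₁ s₂ s₃ =
      ∑' n : ℕ, zetaPartialSum n s₁ * ((n : ℂ) + 1) ^ (-s₂) * zetaTail s₃ n := by
  have hin : ∀ n : ℕ, ∑' n₃ : Set.Ioi (n + 1), ((n₃ : ℕ) : ℂ) ^ (-s₃) = zetaTail s₃ n := by
    intro n
    rw [tsum_Ioi_eq (fun n => (n : ℂ) ^ (-s₃)), zetaTail_eq_tsum h3]
    exact tsum_congr fun j => by push_cast; ring_nf
  -- Giving up half of re s₃ - 1 still leaves positive decay, which makes the inequalities strict
  -- even when re s₁ = re s₂ = 1.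
  obtain ⟨C, hC⟩ := exists_norm_zetaTail_le (s := s₃) (δ := (s₃.re - 1) / 2) (by linarith)
    (by linarith)
  have hb := hasSum_zetaPartialSum_mul (p := s₁) (C := C)
    (b := fun n => ((n : ℂ) + 1) ^ (-s₂) * zetaTail s₃ n) (σ := s₂.re + (s₃.re - 1) / 2)
    (by linarith) (by linarith) (fun n => by
      rw [norm_mul, norm_natCast_add_one_cpow, neg_add, Real.rpow_add (by positivity),
        Complex.neg_re]
      calc _ ≤ ((n : ℝ) + 1) ^ (-s₂.re) *
            (C * ((n : ℝ) + 1) ^ (-(s₃.re - 1 - (s₃.re - 1) / 2))) := by gcongr; exact hC n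
        _ = _ := by rw [show -(s₃.re - 1 - (s₃.re - 1) / 2) = -((s₃.re - 1) / 2) by ring]; ring)
  simp only [mul_assoc]
  rw [hb.tsum_eq, tripleZetaSeries, tsum_Ici_eq fun n₁ => (n₁ : ℂ) ^ (-s₁) *
    ∑' n₂ : Set.Ioi n₁, ((n₂ : ℕ) : ℂ) ^ (-s₂) * ∑' n₃ : Set.Ioi (n₂ : ℕ), ((n₃ : ℕ) : ℂ) ^ (-s₃)]
  refine tsum_congr fun m => ?_
  rw [tsum_Ioi_eq fun n₂ => (n₂ : ℂ) ^ (-s₂) * ∑' n₃ : Set.Ioi n₂, ((n₃ : ℕ) : ℂ) ^ (-s₃)]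
  congr 1
  · push_cast; rfl
  refine tsum_congr fun j => ?_
  rw [← hin, show j + (m + 1) + 1 = j + (m + 1 + 1) from rfl]
  push_cast
  ring_nf

/-- The analytic continuation of the triple zeta function. -/
theorem exists_tripleZeta {D : ℂ × ℂ → ℂ}
    (hD : ∀ s₁ s₂ : ℂ, s₂ ≠ 1 → (∀ l : ℕ, s₁ + s₂ ≠ 2 - l) → DifferentiableAt ℂ D (s₁, s₂))
    (hD' : ∀ s₁ s₂ : ℂ, s₂ ≠ 1 → 2 < (s₁ + s₂).re →
      D (s₁, s₂) = ∑' n : ℕ, ((n : ℂ) + 1) ^ (-s₁) * zetaTail s₂ n) : ∃ Z : ℂ × ℂ × ℂ → ℂ,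
    (∀ s ∈ tripleZetaDomain, DifferentiableAt ℂ Z s) ∧
    ∀ s₁ s₂ s₃ : ℂ, s₃ ≠ 1 → 2 < (s₂ + s₃).re → 3 < (s₁ + s₂ + s₃).re → Z (s₁, s₂, s₃) =
      ∑' n : ℕ, zetaPartialSum n s₁ * ((n : ℂ) + 1) ^ (-s₂) * zetaTail s₃ n := by
  obtain ⟨Z, hZ, hZ'⟩ := exists_continuation_tsum_mul_zetaTail (a := zetaPartialSum)
    (D := D) (V := {x | x.2 ≠ 1 ∧ ∀ l : ℕ, x.1 + x.2 ≠ 2 - l})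
    (V₀ := {x | 1 < x.2.re ∧ 2 < (x.1 + x.2).re}) differentiable_zetaPartialSum
    (fun r => ⟨r + 1, 1, zero_le_one, fun p hp n => norm_zetaPartialSum_le hp n⟩)
    (fun x hx => hD x.1 x.2 hx.1 hx.2)
    (fun x hx => by
      have hx1 : x.2 ≠ 1 := fun h => by simpa [h] using hx.1
      have := hasSum_zetaPartialSum_mul_cpow hx.1 hx.2
      rwa [← hD' x.1 x.2 hx1 hx.2] at this)
    (fun r => ⟨|r| + 2, fun p s hp hs => by
      have := (abs_le.1 ((Complex.abs_re_le_norm _).trans hp)).1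
      have h' := le_abs_self r
      have h'' := abs_nonneg r
      simp only [Set.mem_ofPred_eq, Complex.add_re]
      constructor <;> linarith⟩)
  refine ⟨Z, fun s hs => ?_, fun s₁ s₂ s₃ h3 h23 h123 => ?_⟩
  · obtain ⟨s₁, s₂, s₃⟩ := s
    obtain ⟨h1, h2, h3⟩ := hs
    -- The translate by k - 1 moves the polar lines of `D` to s₂ + s₃ = 2 - k and s₁ + s₂ + s₃ = 3 -
    -- (k + l).
    refine hZ s₁ s₂ s₃ h1 fun k => ⟨fun h => h2 k ?_, fun l h => h3 (k + l) ?_⟩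
    · linear_combination h
    · push_cast
      linear_combination h
  · refine hZ' s₁ s₂ s₃ h3 fun k => ?_
    have := Nat.cast_nonneg (α := ℝ) k
    simp at h23 h123 ⊢
    constructor <;> linarith

/-! ### Identity theorem and uniqueness -/

theorem isClosed_of_subset_range_intCast {s : Set ℂ} (hs : s ⊆ Set.range ((↑) : ℤ → ℂ)) :
    IsClosed s := by
  refine Metric.isClosed_of_pairwise_le_dist one_pos ?_
  intro x hx y hy hxy
  obtain ⟨m, rfl⟩ := hs hx
  obtain ⟨n, rfl⟩ := hs hy
  rw [dist_eq_norm, ← Int.cast_sub, Complex.norm_intCast]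
  exact_mod_cast Int.one_le_abs (sub_ne_zero.2 fun h => hxy (by rw [h]))

/-- The identity theorem off a countable closed subset of `ℂ`. -/
theorem eq_of_eventuallyEq_of_countable {T : Set ℂ} (hT : T.Countable) (hTc : IsClosed T)
    {f g : ℂ → ℂ} (hf : ∀ z ∉ T, DifferentiableAt ℂ f z) (hg : ∀ z ∉ T, DifferentiableAt ℂ g z)
    {z₀ : ℂ} (h₀ : z₀ ∉ T) (h : f =ᶠ[𝓝 z₀] g) {z : ℂ} (hz : z ∉ T) : f z = g z := by
  have hconn := (hT.isPathConnected_compl_of_one_lt_rank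
    (by simp : 1 < Module.rank ℝ ℂ)).isConnected.isPreconnected
  have hf' : DifferentiableOn ℂ f Tᶜ := fun z hz => (hf z hz).differentiableWithinAt
  have hg' : DifferentiableOn ℂ g Tᶜ := fun z hz => (hg z hz).differentiableWithinAt
  exact (hf'.analyticOnNhd hTc.isOpen_compl).eqOn_of_preconnected_of_eventuallyEq
    (hg'.analyticOnNhd hTc.isOpen_compl) hconn h₀ h hz

theorem isOpen_tripleZetaDomain : IsOpen tripleZetaDomain := by
  have hcl : ∀ c : ℕ, IsClosed (Set.range fun l : ℕ => (c : ℂ) - l) := fun c =>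
    isClosed_of_subset_range_intCast (by rintro _ ⟨l, rfl⟩; exact ⟨c - l, by push_cast; rfl⟩)
  have h : tripleZetaDomain = {s | s.2.2 ≠ 1} ∩
      ((fun s : ℂ × ℂ × ℂ => s.2.1 + s.2.2) ⁻¹' (Set.range fun l : ℕ => ((2 : ℕ) : ℂ) - l)ᶜ ∩
        (fun s : ℂ × ℂ × ℂ => s.1 + s.2.1 + s.2.2) ⁻¹'
          (Set.range fun l : ℕ => ((3 : ℕ) : ℂ) - l)ᶜ) := by
    ext s
    simp [tripleZetaDomain, eq_comm]
  rw [h]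
  exact (isOpen_ne_fun (by fun_prop) continuous_const).inter
    (((hcl 2).isOpen_compl.preimage (by fun_prop)).inter
      ((hcl 3).isOpen_compl.preimage (by fun_prop)))

theorem countable_setOf_add_mul_eq {a b c : ℂ} (h : a ≠ c) : {t : ℂ | a + t * b = c}.Countable := by
  refine Set.Subsingleton.countable fun t ht t' ht' => ?_
  simp only [Set.mem_ofPred_eq] at ht ht'
  have hb : b ≠ 0 := by rintro rfl; exact h (by simpa using ht)
  exact mul_right_cancel₀ hb (add_left_cancel (ht.trans ht'.symm))

theorem one_le_re_mem_tripleZetaDomain {s : ℂ × ℂ × ℂ} (h1 : 1 ≤ s.1.re) (h2 : 1 ≤ s.2.1.re)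
    (h3 : 1 < s.2.2.re) : s ∈ tripleZetaDomain := by
  refine ⟨fun h => ?_, fun l h => ?_, fun l h => ?_⟩ <;> have h' := congrArg Complex.re h
  · simp [h] at h3
  all_goals simp at h'; linarith [Nat.cast_nonneg (α := ℝ) l]

/-- Restrict to the complex line through (2, 2, 2) and `p`. It meets each excluded hyperplane at
most once, as (2, 2, 2) lies on none, so only countably many parameters are bad and the one-variable
identity theorem applies. -/
theorem IsTripleZetaContinuation.eqOn {Z Z' : ℂ × ℂ × ℂ → ℂ} (hZ : IsTripleZetaContinuation Z)
    (hZ' : IsTripleZetaContinuation Z') : Set.EqOn Z Z' tripleZetaDomain := by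
  intro p hp
  set q : ℂ × ℂ × ℂ := (2, 2, 2) with hq
  have hqd : q ∈ tripleZetaDomain := one_le_re_mem_tripleZetaDomain (by simp [hq]) (by simp [hq])
    (by simp [hq])
  set γ : ℂ → ℂ × ℂ × ℂ := fun t => q + t • (p - q) with hγ
  have hγd : ∀ t, DifferentiableAt ℂ γ t := fun t => by simp only [hγ]; fun_prop
  have hγc : Continuous γ := continuous_iff_continuousAt.2 fun t => (hγd t).continuousAt
  have hγ0 : γ 0 = q := by simp [hγ]
  have hT : {t | γ t ∉ tripleZetaDomain}.Countable := by
    have hsub : {t | γ t ∉ tripleZetaDomain} ⊆ {t | q.2.2 + t * (p - q).2.2 = 1} ∪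
        ((⋃ l : ℕ, {t | (q.2.1 + q.2.2) + t * ((p - q).2.1 + (p - q).2.2) = 2 - l}) ∪
          ⋃ l : ℕ, {t | (q.1 + q.2.1 + q.2.2) +
            t * ((p - q).1 + (p - q).2.1 + (p - q).2.2) = 3 - l}) := by
      intro t ht
      by_contra hcon
      simp only [Set.mem_union, Set.mem_iUnion, Set.mem_ofPred_eq, not_or, not_exists] at hcon
      refine ht ⟨fun h => hcon.1 ?_, fun l h => hcon.2.1 l ?_, fun l h => hcon.2.2 l ?_⟩ <;>
        rw [← h] <;> simp [hγ] <;> ring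
    exact ((countable_setOf_add_mul_eq hqd.1).union
      ((Set.countable_iUnion fun l => countable_setOf_add_mul_eq (hqd.2.1 l)).union
        (Set.countable_iUnion fun l => countable_setOf_add_mul_eq (hqd.2.2 l)))).mono hsub
  have hTc : IsClosed {t | γ t ∉ tripleZetaDomain} :=
    (isOpen_tripleZetaDomain.preimage hγc).isClosed_compl
  have h1 : γ 1 = p := by simp [hγ]
  have hev : (fun t => Z (γ t)) =ᶠ[𝓝 0] fun t => Z' (γ t) := by
    have hO : IsOpen ({s : ℂ × ℂ × ℂ | 1 < s.1.re} ∩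
        ({s : ℂ × ℂ × ℂ | 1 < s.2.1.re} ∩ {s : ℂ × ℂ × ℂ | 1 < s.2.2.re})) :=
      (isOpen_lt continuous_const (Complex.continuous_re.comp (by fun_prop))).inter
        ((isOpen_lt continuous_const (Complex.continuous_re.comp (by fun_prop))).inter
          (isOpen_lt continuous_const (Complex.continuous_re.comp (by fun_prop))))
    filter_upwards [(hO.preimage hγc).eventually_mem (show (0 : ℂ) ∈ _ by
      simp [hγ0, hq])] with t ht
    rw [hZ.eq_series _ _ _ ht.1.le ht.2.1.le ht.2.2, hZ'.eq_series _ _ _ ht.1.le ht.2.1.le ht.2.2]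
  have := eq_of_eventuallyEq_of_countable hT hTc
    (f := fun t => Z (γ t)) (g := fun t => Z' (γ t))
    (fun t ht => (hZ.differentiableAt _ (not_not.1 ht)).comp t (hγd t))
    (fun t ht => (hZ'.differentiableAt _ (not_not.1 ht)).comp t (hγd t))
    (z₀ := 0) (by simpa [hγ0] using hqd) hev (z := 1) (by simpa [h1] using hp)
  simpa only [h1] using this

/-! ### Values at nonpositive integers -/

theorem bernoulliBar_eq (k : ℕ) : bernoulliBar k = (bernoulli' k : ℂ) := by
  rw [bernoulliBar, Polynomial.bernoulli_eval_one]

/-- At a non-positive integer the tail of the zeta function is given by a Bernoulli polynomial. -/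
theorem zetaTail_neg_natCast (m n : ℕ) : zetaTail (-(m : ℂ)) n =
    -∑ k ∈ Finset.range (m + 2), ((m + 1).choose k : ℂ) * (bernoulliBar k / ((m : ℂ) + 1)) *
      ((n : ℂ) + 1) ^ ((m : ℂ) + 1 - k) := by
  have hn : (n : ℂ) + 1 ≠ 0 := Nat.cast_add_one_ne_zero n
  have h := congrArg (fun q : ℚ => (q : ℂ)) (sum_Ico_pow (n + 1) m)
  rw [Finset.sum_Ico_eq_sum_range] at h
  simp only [add_tsub_cancel_right] at h
  push_cast at h
  have h1 : ∑ i ∈ Finset.range (n + 1), ((i : ℂ) + 1) ^ (-(-(m : ℂ))) =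
      ∑ i ∈ Finset.range (n + 1), (1 + (i : ℂ)) ^ m :=
    Finset.sum_congr rfl fun i _ => by rw [neg_neg, Complex.cpow_natCast, add_comm]
  -- Faulhaber's formula gives the terms k ≤ m; ζ(-m) is the constant term k = m + 1.
  rw [zetaTail, riemannZeta_neg_nat_eq_bernoulli', h1, h, Finset.sum_range_succ _ (m + 1), neg_add,
    bernoulliBar_eq]
  have h2 : ∀ k ∈ Finset.range (m + 1), ((m + 1).choose k : ℂ) * (bernoulliBar k / ((m : ℂ) + 1)) *
      ((n : ℂ) + 1) ^ ((m : ℂ) + 1 - k) =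
      (bernoulli' k : ℂ) * ((m + 1).choose k) * ((n : ℂ) + 1) ^ (m + 1 - k) / ((m : ℂ) + 1) := by
    intro k hk
    have hk' : k ≤ m + 1 := (Finset.mem_range.1 hk).le
    rw [bernoulliBar_eq, ← Complex.cpow_natCast, Nat.cast_sub hk']
    push_cast
    ring
  rw [Finset.sum_congr rfl h2]
  simp
  ring

/-- The value at `-m` of the continued tail sums of a Dirichlet series. -/
theorem hasSum_mul_zetaTail_neg_natCast {a : ℕ → ℂ} {D : ℂ → ℂ} {s : ℂ} {m : ℕ}
    (h : ∀ k ∈ Finset.range (m + 2), HasSum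
      (fun n => a n * ((n : ℂ) + 1) ^ (-(s - ((m : ℂ) + 1 - k)))) (D (s - ((m : ℂ) + 1 - k)))) :
    HasSum (fun n => a n * ((n : ℂ) + 1) ^ (-s) * zetaTail (-(m : ℂ)) n)
      (-∑ k ∈ Finset.range (m + 2), ((m + 1).choose k : ℂ) * (bernoulliBar k / ((m : ℂ) + 1)) *
        D (s - ((m : ℂ) + 1 - k))) := by
  have h1 := (hasSum_sum fun k hk =>
    (h k hk).mul_left (((m + 1).choose k : ℂ) * (bernoulliBar k / ((m : ℂ) + 1)))).neg
  refine h1.congr_fun fun n => ?_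
  rw [zetaTail_neg_natCast, mul_neg, Finset.mul_sum]
  congr 1
  refine Finset.sum_congr rfl fun k _ => ?_
  rw [show -(s - ((m : ℂ) + 1 - k)) = -s + ((m : ℂ) + 1 - k) by ring,
    Complex.cpow_add _ _ (Nat.cast_add_one_ne_zero n)]
  ring

theorem eventually_re_gt {c : ℝ} {z : ℂ} (h : c < z.re) : ∀ᶠ w in 𝓝 z, c < w.re :=
  (isOpen_lt continuous_const Complex.continuous_re).eventually_mem h

theorem isClosed_range_intCast_complex : IsClosed (Set.range ((↑) : ℤ → ℂ)) :=
  isClosed_of_subset_range_intCast subset_rfl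

theorem eventually_notMem_range_intCast {z : ℂ} (hz : z ∉ Set.range ((↑) : ℤ → ℂ)) :
    ∀ᶠ w in 𝓝 z, w ∉ Set.range ((↑) : ℤ → ℂ) :=
  isClosed_range_intCast_complex.isOpen_compl.eventually_mem hz

theorem eventually_nhdsNE_notMem_range_intCast (z : ℂ) :
    ∀ᶠ w in 𝓝[≠] z, w ∉ Set.range ((↑) : ℤ → ℂ) := by
  have hcl : IsClosed (Set.range ((↑) : ℤ → ℂ) \ {z}) :=
    isClosed_of_subset_range_intCast Set.sdiff_subset
  filter_upwards [self_mem_nhdsWithin, mem_nhdsWithin_of_mem_nhds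
    (hcl.isOpen_compl.mem_nhds (x := z) (by simp))] with w hw hw'
  exact fun h => hw' ⟨h, hw⟩

theorem notMem_range_intCast_of_im_pos {z : ℂ} (hz : 0 < z.im) :
    z ∉ Set.range ((↑) : ℤ → ℂ) := by
  rintro ⟨n, rfl⟩
  simp at hz

/-- Both sides are holomorphic off the integers and agree, by termwise summation, for re s > m + 2.
The base point has positive imaginary part to avoid the integers. -/
theorem doubleZeta_neg_natCast {D : ℂ × ℂ → ℂ}
    (hD : ∀ s₁ s₂ : ℂ, s₂ ≠ 1 → (∀ l : ℕ, s₁ + s₂ ≠ 2 - l) → DifferentiableAt ℂ D (s₁, s₂))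
    (hD' : ∀ s₁ s₂ : ℂ, s₂ ≠ 1 → 2 < (s₁ + s₂).re →
      D (s₁, s₂) = ∑' n : ℕ, ((n : ℂ) + 1) ^ (-s₁) * zetaTail s₂ n)
    (m : ℕ) {s : ℂ} (hs : s ∉ Set.range ((↑) : ℤ → ℂ)) :
    D (s, -(m : ℂ)) = -∑ k ∈ Finset.range (m + 2), ((m + 1).choose k : ℂ) *
      (bernoulliBar k / ((m : ℂ) + 1)) * riemannZeta (s - ((m : ℂ) + 1 - k)) := by
  have hm1 : -(m : ℂ) ≠ 1 := fun h => by
    have := congrArg Complex.re h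
    simp at this
    linarith [Nat.cast_nonneg (α := ℝ) m]
  refine eq_of_eventuallyEq_of_countable (Set.countable_range _) isClosed_range_intCast_complex
    (f := fun s => D (s, -(m : ℂ)))
    (g := fun s => -∑ k ∈ Finset.range (m + 2), ((m + 1).choose k : ℂ) *
      (bernoulliBar k / ((m : ℂ) + 1)) * riemannZeta (s - ((m : ℂ) + 1 - k)))
    (fun z hz => ?_) (fun z hz => ?_) (z₀ := ⟨m + 3, 1⟩)
    (notMem_range_intCast_of_im_pos (by simp)) ?_ hs
  · refine DifferentiableAt.comp z (f := fun s : ℂ => (s, -(m : ℂ)))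
      (hD z _ hm1 fun l h => hz ⟨2 - l + m, ?_⟩) (by fun_prop)
    push_cast
    linear_combination -h
  · refine (DifferentiableAt.fun_sum fun k _ => DifferentiableAt.const_mul ?_ _).neg
    refine DifferentiableAt.comp z (f := fun s : ℂ => s - ((m : ℂ) + 1 - k))
      (differentiableAt_riemannZeta fun h => hz ⟨m + 2 - k, ?_⟩) (by fun_prop)
    push_cast
    linear_combination -h
  · filter_upwards [eventually_re_gt (c := m + 2) (z := ⟨m + 3, 1⟩) (by simp; norm_num)] with z hz
    have h := hasSum_mul_zetaTail_neg_natCast (a := fun _ => 1) (D := riemannZeta) (s := z) (m := m)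
      fun k _ => by
        have hre : 1 < (z - ((m : ℂ) + 1 - k)).re := by
          simp
          linarith [Nat.cast_nonneg (α := ℝ) k]
        rw [riemannZeta_eq_tsum_cpow_neg hre]
        simpa only [one_mul] using (summable_natCast_add_one_cpow hre).hasSum
    rw [hD' z _ hm1 (by simp; linarith), ← h.tsum_eq]
    simp only [one_mul]

/-- The same argument in s₂ with s₁ fixed; the excluded set is now the integers together with their
translates by -s₁. -/
theorem tripleZeta_neg_natCast {D : ℂ × ℂ → ℂ}
    (hD : ∀ s₁ s₂ : ℂ, s₂ ≠ 1 → (∀ l : ℕ, s₁ + s₂ ≠ 2 - l) → DifferentiableAt ℂ D (s₁, s₂))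
    (hD' : ∀ s₁ s₂ : ℂ, s₂ ≠ 1 → 2 < (s₁ + s₂).re →
      D (s₁, s₂) = ∑' n : ℕ, ((n : ℂ) + 1) ^ (-s₁) * zetaTail s₂ n)
    {Z : ℂ × ℂ × ℂ → ℂ} (hZ : ∀ s ∈ tripleZetaDomain, DifferentiableAt ℂ Z s)
    (hZ' : ∀ s₁ s₂ s₃ : ℂ, s₃ ≠ 1 → 2 < (s₂ + s₃).re → 3 < (s₁ + s₂ + s₃).re → Z (s₁, s₂, s₃) =
      ∑' n : ℕ, zetaPartialSum n s₁ * ((n : ℂ) + 1) ^ (-s₂) * zetaTail s₃ n)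
    (m : ℕ) {s₁ s₂ : ℂ} (hs₂ : s₂ ∉ Set.range ((↑) : ℤ → ℂ))
    (hs : s₁ + s₂ ∉ Set.range ((↑) : ℤ → ℂ)) :
    (s₁, s₂, -(m : ℂ)) ∈ tripleZetaDomain ∧
    Z (s₁, s₂, -(m : ℂ)) = -∑ k ∈ Finset.range (m + 2), ((m + 1).choose k : ℂ) *
      (bernoulliBar k / ((m : ℂ) + 1)) * D (s₁, s₂ - ((m : ℂ) + 1 - k)) := by
  have hm1 : -(m : ℂ) ≠ 1 := fun h => by
    have := congrArg Complex.re h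
    simp at this
    linarith [Nat.cast_nonneg (α := ℝ) m]
  set T : Set ℂ := Set.range ((↑) : ℤ → ℂ) ∪ (fun z => s₁ + z) ⁻¹' Set.range ((↑) : ℤ → ℂ)
  have hTcount : T.Countable := (Set.countable_range _).union
    ((Set.countable_range _).preimage (add_right_injective s₁))
  have hTcl : IsClosed T := isClosed_range_intCast_complex.union
    (isClosed_range_intCast_complex.preimage (by fun_prop))
  have hdom : ∀ z ∉ T, (s₁, z, -(m : ℂ)) ∈ tripleZetaDomain := by
    intro z hz
    refine ⟨hm1, fun l h => hz (Or.inl ⟨2 - l + m, ?_⟩), fun l h => hz (Or.inr ⟨3 - l + m, ?_⟩)⟩ <;>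
    · push_cast
      linear_combination -h
  have hsT : s₂ ∉ T := fun h => h.elim hs₂ hs
  refine ⟨hdom s₂ hsT, ?_⟩
  have him : 0 ≤ s₁.im + |s₁.im| := by linarith [neg_abs_le s₁.im]
  have hre : 0 ≤ s₁.re + |s₁.re| := by linarith [neg_abs_le s₁.re]
  refine eq_of_eventuallyEq_of_countable hTcount hTcl
    (f := fun z => Z (s₁, z, -(m : ℂ)))
    (g := fun z => -∑ k ∈ Finset.range (m + 2), ((m + 1).choose k : ℂ) *
      (bernoulliBar k / ((m : ℂ) + 1)) * D (s₁, z - ((m : ℂ) + 1 - k)))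
    -- Both z₀ and s₁ + z₀ have positive imaginary part, so z₀ avoids `T`; its real part puts it in
    -- the region of convergence whatever s₁ is.
    (fun z hz => ?_) (fun z hz => ?_) (z₀ := ⟨m + 4 + |s₁.re|, 1 + |s₁.im|⟩)
    (fun h => h.elim (notMem_range_intCast_of_im_pos (by simp; positivity))
      (notMem_range_intCast_of_im_pos (by simp; linarith))) ?_ hsT
  · exact DifferentiableAt.comp z (f := fun z : ℂ => (s₁, z, -(m : ℂ))) (hZ _ (hdom z hz))
      (by fun_prop)
  · refine (DifferentiableAt.fun_sum fun k _ => DifferentiableAt.const_mul ?_ _).neg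
    refine DifferentiableAt.comp z (f := fun z : ℂ => (s₁, z - ((m : ℂ) + 1 - k)))
      (hD _ _ (fun h => hz (Or.inl ⟨m + 2 - k, ?_⟩)) fun l h => hz (Or.inr ⟨2 - l + (m + 1 - k), ?_⟩))
      (by fun_prop)
    · push_cast
      linear_combination -h
    · push_cast
      linear_combination -h
  · filter_upwards [eventually_re_gt (c := m + 3 + |s₁.re|)
      (z := ⟨m + 4 + |s₁.re|, 1 + |s₁.im|⟩) (by simp; norm_num)] with z hz
    have h := hasSum_mul_zetaTail_neg_natCast (a := fun n => zetaPartialSum n s₁)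
      (D := fun s => D (s₁, s)) (s := z) (m := m) fun k _ => by
        have hk := Nat.cast_nonneg (α := ℝ) k
        have hr := abs_nonneg s₁.re
        have h2 : 1 < (z - ((m : ℂ) + 1 - k)).re := by
          simp
          linarith
        have h12 : 2 < (s₁ + (z - ((m : ℂ) + 1 - k))).re := by
          simp
          linarith
        rw [hD' _ _ (fun h => by simp [h] at h2) h12]
        exact hasSum_zetaPartialSum_mul_cpow h2 h12
    have hr := abs_nonneg s₁.re
    rw [hZ' s₁ z _ hm1 (by simp; linarith) (by simp; linarith), ← h.tsum_eq]

/-! ### The iterated limit -/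

theorem isTripleZetaContinuation_of_eq_tsum {Z : ℂ × ℂ × ℂ → ℂ}
    (hZ : ∀ s ∈ tripleZetaDomain, DifferentiableAt ℂ Z s)
    (hZ' : ∀ s₁ s₂ s₃ : ℂ, s₃ ≠ 1 → 2 < (s₂ + s₃).re → 3 < (s₁ + s₂ + s₃).re → Z (s₁, s₂, s₃) =
      ∑' n : ℕ, zetaPartialSum n s₁ * ((n : ℂ) + 1) ^ (-s₂) * zetaTail s₃ n) :
    IsTripleZetaContinuation Z where
  differentiableAt := hZ
  eq_series s₁ s₂ s₃ h1 h2 h3 := by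
    rw [tripleZetaSeries_eq h1 h2 h3]
    exact hZ' s₁ s₂ s₃ (fun h => by simp [h] at h3) (by simp; linarith) (by simp; linarith)

theorem mainTheorem1 (s₁ : ℂ) (m₂ m₃ : ℕ)
    (hs₁ : s₁.re ≤ 0 ∨ (0 < s₁.re ∧ ∀ n : ℤ, s₁ ≠ (n : ℂ))) :
    (IsTripleZetaContinuation tripleZeta ∧
      ∀ Z : ℂ × ℂ × ℂ → ℂ, IsTripleZetaContinuation Z → Set.EqOn Z tripleZeta tripleZetaDomain) ∧
    HasIteratedLimit tripleZeta s₁ (-(m₂ : ℂ)) (-(m₃ : ℂ))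
      (∑ k₃ ∈ Finset.range (m₃ + 2),
        ((m₃ + 1).choose k₃ : ℂ) * (bernoulliBar k₃ / ((m₃ : ℂ) + 1)) *
          ∑ k₂ ∈ Finset.range (m₂ + m₃ + 2 - k₃ + 1),
            ((m₂ + m₃ + 2 - k₃).choose k₂ : ℂ) *
              (bernoulliBar k₂ / ((m₂ : ℂ) + m₃ + 2 - k₃)) *
              riemannZeta (s₁ - ((m₂ : ℂ) + m₃ + 2 - k₂ - k₃))) := by
  obtain ⟨D, hD, hD'⟩ := exists_doubleZeta
  obtain ⟨Z, hZ, hZ'⟩ := exists_tripleZeta hD hD'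
  have hcont := isTripleZetaContinuation_of_eq_tsum hZ hZ'
  have htz : IsTripleZetaContinuation tripleZeta := by
    have hex : ∃ Z, IsTripleZetaContinuation Z := ⟨Z, hcont⟩
    rw [tripleZeta, dif_pos hex]
    exact hex.choose_spec
  refine ⟨⟨htz, fun Z' hZ' => hZ'.eqOn htz⟩, ?_⟩
  have heq := hcont.eqOn htz
  refine ⟨fun s₁ s₂ => Z (s₁, s₂, -(m₃ : ℂ)), fun s₁ => -∑ k ∈ Finset.range (m₃ + 2),
    ((m₃ + 1).choose k : ℂ) * (bernoulliBar k / ((m₃ : ℂ) + 1)) *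
      D (s₁, -(m₂ : ℂ) - ((m₃ : ℂ) + 1 - k)), ?_, ?_, ?_⟩
  · filter_upwards [eventually_nhdsNE_notMem_range_intCast s₁] with s hs
    have hev : ∀ᶠ s₂ in 𝓝 (-(m₂ : ℂ)), s + s₂ ∉ Set.range ((↑) : ℤ → ℂ) :=
      (continuous_const.add continuous_id).continuousAt.eventually
        (eventually_notMem_range_intCast (z := s + -(m₂ : ℂ)) (by
          rintro ⟨n, hn⟩
          exact hs ⟨n + m₂, by push_cast; rw [hn]; ring⟩))
    filter_upwards [eventually_nhdsNE_notMem_range_intCast _, hev.filter_mono nhdsWithin_le_nhds]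
      with s₂ hs₂ hss
    have hmem := (tripleZeta_neg_natCast hD hD' hZ hZ' m₃ hs₂ hss).1
    rw [heq hmem]
    have hc : ContinuousAt (fun s₃ => tripleZeta (s, s₂, s₃)) (-(m₃ : ℂ)) :=
      ContinuousAt.comp (f := fun s₃ : ℂ => (s, s₂, s₃))
        (htz.differentiableAt _ hmem).continuousAt (by fun_prop)
    exact hc.tendsto.mono_left nhdsWithin_le_nhds
  · filter_upwards [eventually_nhdsNE_notMem_range_intCast s₁] with s hs
    have hev : ∀ᶠ s₂ in 𝓝 (-(m₂ : ℂ)), s + s₂ ∉ Set.range ((↑) : ℤ → ℂ) :=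
      (continuous_const.add continuous_id).continuousAt.eventually
        (eventually_notMem_range_intCast (z := s + -(m₂ : ℂ)) (by
          rintro ⟨n, hn⟩
          exact hs ⟨n + m₂, by push_cast; rw [hn]; ring⟩))
    have hlim : Tendsto (fun s₂ => -∑ k ∈ Finset.range (m₃ + 2),
        ((m₃ + 1).choose k : ℂ) * (bernoulliBar k / ((m₃ : ℂ) + 1)) *
          D (s, s₂ - ((m₃ : ℂ) + 1 - k))) (𝓝 (-(m₂ : ℂ))) (𝓝 (-∑ k ∈ Finset.range (m₃ + 2),
        ((m₃ + 1).choose k : ℂ) * (bernoulliBar k / ((m₃ : ℂ) + 1)) *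
          D (s, -(m₂ : ℂ) - ((m₃ : ℂ) + 1 - k)))) := by
      refine (tendsto_finsetSum _ fun k hk => Tendsto.const_mul _ ?_).neg
      have hk' : (k : ℝ) < m₃ + 2 := by exact_mod_cast Finset.mem_range.1 hk
      refine ContinuousAt.tendsto (ContinuousAt.comp (f := fun s₂ : ℂ => (s, s₂ - ((m₃ : ℂ) + 1 - k)))
        (hD _ _ (fun h => ?_) fun l h => hs ⟨2 - l + m₂ + (m₃ + 1 - k), ?_⟩).continuousAt
        (by fun_prop))
      -- As k ≤ m₃ + 1, the second argument of `D` has real part at most 0, so it is not 1.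
      · have := congrArg Complex.re h
        simp at this
        linarith [Nat.cast_nonneg (α := ℝ) m₂]
      · push_cast
        linear_combination -h
    refine (hlim.mono_left nhdsWithin_le_nhds).congr' ?_
    filter_upwards [eventually_nhdsNE_notMem_range_intCast _, hev.filter_mono nhdsWithin_le_nhds]
      with s₂ hs₂ hss
    exact (tripleZeta_neg_natCast hD hD' hZ hZ' m₃ hs₂ hss).2.symm
  · have hlim : ContinuousAt (fun s => ∑ k₃ ∈ Finset.range (m₃ + 2),
        ((m₃ + 1).choose k₃ : ℂ) * (bernoulliBar k₃ / ((m₃ : ℂ) + 1)) *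
          ∑ k₂ ∈ Finset.range (m₂ + m₃ + 2 - k₃ + 1),
            ((m₂ + m₃ + 2 - k₃).choose k₂ : ℂ) *
              (bernoulliBar k₂ / ((m₂ : ℂ) + m₃ + 2 - k₃)) *
              riemannZeta (s - ((m₂ : ℂ) + m₃ + 2 - k₂ - k₃))) s₁ := by
      refine tendsto_finsetSum _ fun k₃ hk₃ => Tendsto.const_mul _ ?_
      refine tendsto_finsetSum _ fun k₂ hk₂ => Tendsto.const_mul _ ?_
      refine ContinuousAt.tendsto (ContinuousAt.comp
        (f := fun s : ℂ => s - ((m₂ : ℂ) + m₃ + 2 - k₂ - k₃))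
        (differentiableAt_riemannZeta fun h => ?_).continuousAt (by fun_prop))
      have hk : (k₂ : ℝ) + k₃ ≤ m₂ + m₃ + 2 := by
        rw [Finset.mem_range] at hk₂ hk₃
        exact_mod_cast (by omega : k₂ + k₃ ≤ m₂ + m₃ + 2)
      -- A pole would force s₁ = m₂ + m₃ + 3 - k₂ - k₃, an integer at least 1.
      rcases hs₁ with hs₁ | hs₁
      · have := congrArg Complex.re h
        simp at this
        linarith
      · refine hs₁.2 (m₂ + m₃ + 3 - k₂ - k₃) ?_
        push_cast
        linear_combination h
    refine (hlim.tendsto.mono_left nhdsWithin_le_nhds).congr' ?_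
    filter_upwards [eventually_nhdsNE_notMem_range_intCast s₁] with s hs
    rw [← Finset.sum_neg_distrib]
    refine Finset.sum_congr rfl fun k₃ hk₃ => ?_
    have hk₃' : k₃ ≤ m₃ + 1 := Nat.lt_succ_iff.1 (Finset.mem_range.1 hk₃)
    -- The second argument of `D` is -M with M = m₂ + m₃ + 1 - k₃ a natural number; the minus signs
    -- of the two reductions cancel.
    obtain ⟨M, hM⟩ : ∃ M, m₂ + m₃ + 2 - k₃ = M + 1 := ⟨m₂ + m₃ + 1 - k₃, by omega⟩
    have hMc : (m₂ : ℂ) + m₃ + 2 - k₃ = M + 1 := by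
      have : ((m₂ + m₃ + 2 : ℕ) : ℂ) = ((M + 1 + k₃ : ℕ) : ℂ) := by congr 1; omega
      push_cast at this
      linear_combination this
    rw [hM, hMc, show -(m₂ : ℂ) - ((m₃ : ℂ) + 1 - k₃) = -(M : ℂ) by linear_combination -hMc,
      doubleZeta_neg_natCast hD hD' M hs, mul_neg, neg_neg]
    congr 1
    refine Finset.sum_congr rfl fun k₂ _ => ?_
    rw [show (m₂ : ℂ) + m₃ + 2 - k₂ - k₃ = M + 1 - k₂ by linear_combination hMc]
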